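/- Let $N\ge 2$, $s\in(\tfrac12,1)$ and $\mathbf p\in[2,\infty)$. Let $\alpha_{\mathbf p}\in(0,\tfrac\pi2]$ be the angle for which the spherical cap $A_{\mathbf p}=\{|z|=1:\angle(e_1,z)<\alpha_{\mathbf p}\}\subset\mathbb R^N$ satisfies $\mathbf p-1=\int_{A_{\mathbf p}}\langle z,e_1\rangle^2d\sigma\big/\int_{A_{\mathbf p}}\langle z,e_2\rangle^2d\sigma$, where $\sigma$ is the surface measure. For $|y|=1$ and $a\ge 0$ put $T^{a,\infty}_{\mathbf p}(y)=\{z\in\mathbb R^N:\angle(y,z)<\alpha_{\mathbf p},\ |z|>a\}$ and $T^{a,\infty}_{\mathbf p}=T^{a,\infty}_{\mathbf p}(e_1)$. Let $d\mu(z)=C(N,s)|z|^{-N-2s}dz$ with $C(N,s)=\frac{4^s s\,\Gamma(N/2+s)}{\pi^{N/2}\Gamma(1-s)}$. For a bounded Borel function $u:\mathbb R^N\to\mathbb R$ and $\epsilon>0$ define $$\mathcal A_\epsilon u(x)=\frac12\Big(\sup_{|y|=1}\frac{1}{\mu(T^{\epsilon,\infty}_{\mathbf p}(y))}\int_{T^{\epsilon,\infty}_{\mathbf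 p}(y)}u(x+z)\,d\mu(z)+\inf_{|y|=1}\frac{1}{\mu(T^{\epsilon,\infty}_{\mathbf p}(y))}\int_{T^{\epsilon,\infty}_{\mathbf p}(y)}u(x+z)\,d\mu(z)\Big).$$ Let $\mathcal D\subset\mathbb R^N$ be open and bounded, let $F:\mathbb R^N\to\mathbb R$ be bounded and uniformly continuous, and let $\epsilon\in(0,1)$. The game. Let $\Omega_1=T^{1,\infty}_{\mathbf p}\times\{1,2\}$ carry the product $\mathbb P_1$ of the normalized measure $\mu/\mu(T^{1,\infty}_{\mathbf p})$ and the uniform probability on $\{1,2\}$, and let $(\Omega,\mathbb P)=(\Omega_1,\mathbb P_1)^{\mathbb N}$, with elements $\omega=\{(z_n,s_n)\}_{n\ge1}$. A strategy is a sequence of Borel maps $\sigma^n:H_n\to\{|y|=1\}$, $n\ge 0$, on the finite histories $H_n=\mathbb R^N\times(\mathbb R^N\times\Omega_1)^n$. For a unit vector $y$ let $R_{y}\in SO(N)$ be the rotation in the plane spanned by $e_1$ and $y$ that sends $e_1$ to $y$ ($R_{e_1}=\mathrm{Id}$, and $R_{-e_1}$ is the half-turn in the plane spanned by $e_1,e_2$).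 Given $x\in\mathbb R^N$ and strategies $\sigma_I,\sigma_{II}$, put $X_0=x$ and $X_n=X_{n-1}+\epsilon R_{y_n}z_n$, where $y_n$ is the value of $\sigma_I^{n-1}$ if $s_n=1$ and of $\sigma_{II}^{n-1}$ if $s_n=2$, at the history $(X_0,(X_1,z_1,s_1),\dots,(X_{n-1},z_{n-1},s_{n-1}))$. Let $\tau=\min\{n\ge1: X_n\notin\mathcal D\}$, which is finite almost surely, and define $$u_I^\epsilon(x)=\sup_{\sigma_I}\inf_{\sigma_{II}}\mathbb E[F(X_\tau)],\qquad u_{II}^\epsilon(x)=\inf_{\sigma_{II}}\sup_{\sigma_I}\mathbb E[F(X_\tau)].$$ Then there is exactly one bounded Borel function $u_\epsilon:\mathbb R^N\to\mathbb R$ with $$u_\epsilon=\mathcal A_\epsilon u_\epsilon\ \text{ in }\mathcal D,\qquad u_\epsilon=F\ \text{ in }\mathbb R^N\setminus\mathcal D,$$ and $u_I^\epsilon=u_{II}^\epsilon$ on $\mathbb R^N$, while $u_I^\epsilon=u_{II}^\epsilon=u_\epsilon$ in $\mathcal D$. -/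

import Mathlib

open MeasureTheory

namespace NonlocalTug

/-- The space `ℝᴺ`. -/
abbrev E (N : ℕ) := EuclideanSpace ℝ (Fin N)

/-- The unit sphere `{|y| = 1}` of `ℝᴺ`. -/
abbrev S (N : ℕ) := Metric.sphere (0 : E N) 1

section Cone

variable {N : ℕ} [N.AtLeastTwo]

/-- First vector of the standard basis. -/
noncomputable def e₁ : E N := EuclideanSpace.single (0 : Fin N) (1 : ℝ)

/-- Second vector of the standard basis (it differs from `e₁` because `2 ≤ N`). -/
noncomputable def e₂ : E N := EuclideanSpace.single (1 : Fin N) (1 : ℝ)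

/-- The spherical cap of directions making an angle smaller than `α` with `e₁`. -/
def cap (N : ℕ) [N.AtLeastTwo] (α : ℝ) : Set (S N) :=
  {z | InnerProductGeometry.angle e₁ (z : E N) < α}

/-- `α ∈ (0, π/2]` is an aperture angle for the exponent `p`:
`p - 1 = ∫_{cap} ⟨z, e₁⟩² dσ / ∫_{cap} ⟨z, e₂⟩² dσ`, with `σ` the surface measure of the sphere. -/
def IsApertureAngle (N : ℕ) [N.AtLeastTwo] (p α : ℝ) : Prop :=
  0 < α ∧ α ≤ Real.pi / 2 ∧
    p - 1 = (∫ z in cap N α, inner ℝ (z : E N) e₁ ^ 2 ∂(volume : Measure (E N)).toSphere) /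
      (∫ z in cap N α, inner ℝ (z : E N) e₂ ^ 2 ∂(volume : Measure (E N)).toSphere)

/-- The aperture angle `α_p` (for `2 ≤ p` it exists, see `isApertureAngle_apertureAngle`). -/
noncomputable def apertureAngle (N : ℕ) [N.AtLeastTwo] (p : ℝ) : ℝ :=
  Classical.epsilon (IsApertureAngle N p)

/-- The truncated infinite cone `T_p^{a,∞}(y)`. -/
def cone (p a : ℝ) (y : E N) : Set (E N) :=
  {z | InnerProductGeometry.angle y z < apertureAngle N p ∧ a < ‖z‖}

/-- The rotation `R_{y,e₁}`, which sends `e₁` to the unit vector `y` within the plane spanned by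
`e₁` and `y` and fixes the orthogonal complement of this plane, written as the product of the
reflections in the hyperplanes orthogonal to `e₁` and to `e₁ + y`. For `y = -e₁` the two vectors
span no plane, and we take the half-turn in the plane spanned by `e₁` and `e₂`. -/
noncomputable def rot (y : S N) : E N ≃ₗᵢ[ℝ] E N :=
  open Classical in
  if (y : E N) = -e₁ then
    (Submodule.reflection (Submodule.span ℝ {(e₁ : E N)})ᗮ).trans
      (Submodule.reflection (Submodule.span ℝ {(e₂ : E N)})ᗮ)
  else
    (Submodule.reflection (Submodule.span ℝ {(e₁ : E N)})ᗮ).trans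
      (Submodule.reflection (Submodule.span ℝ {(e₁ : E N) + (y : E N)})ᗮ)

end Cone

/-- The map of the sphere induced by a linear isometry preserves the surface measure. -/
lemma toSphere_preserving {N : ℕ} (R : E N ≃ₗᵢ[ℝ] E N) (φ : S N → S N) (hφ : Measurable φ)
    (h : ∀ z, (φ z : E N) = R z) :
    MeasurePreserving φ (volume : Measure (E N)).toSphere (volume : Measure (E N)).toSphere := by
  refine ⟨hφ, ?_⟩
  ext t ht
  rw [Measure.map_apply hφ ht, Measure.toSphere_apply' _ ht, Measure.toSphere_apply' _ (hφ ht)]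
  congr 1
  have hR : MeasurePreserving R.toHomeomorph.toMeasurableEquiv
      (volume : Measure (E N)) volume := R.measurePreserving
  refine (congrArg _ ?_).trans (hR.measure_preimage_equiv _)
  ext w
  simp only [Set.mem_smul, Set.mem_image, Set.mem_preimage]
  constructor
  · rintro ⟨r, hr, _, ⟨z, hz, rfl⟩, rfl⟩
    exact ⟨r, hr, _, ⟨φ z, hz, rfl⟩, by rw [h]; exact (R.map_smul r _).symm⟩
  · rintro ⟨r, hr, _, ⟨z, hz, rfl⟩, hw⟩
    have hz1 : ‖R.symm (z : E N)‖ = 1 := by simp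
    let z' : S N := ⟨R.symm z, by simp⟩
    have hz' : φ z' = z := Subtype.ext (by rw [h]; exact R.apply_symm_apply _)
    refine ⟨r, hr, _, ⟨z', by rwa [hz'], rfl⟩, ?_⟩
    apply R.injective
    rw [R.map_smul]
    show r • R (R.symm z) = _
    rw [R.apply_symm_apply, hw]
    rfl

section ConeFacts

variable {N : ℕ} [N.AtLeastTwo]

lemma norm_e₁ : ‖(e₁ : E N)‖ = 1 := by simp [e₁]

lemma norm_e₂ : ‖(e₂ : E N)‖ = 1 := by simp [e₂]

lemma inner_e₁_e₂ : inner ℝ (e₁ : E N) e₂ = 0 := by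
  have h : (0 : Fin N) ≠ 1 := by
    have h2 : 2 ≤ N := Nat.AtLeastTwo.prop
    intro h
    have := congrArg Fin.val h
    rw [Fin.val_zero, Fin.val_one', Nat.mod_eq_of_lt h2] at this
    exact zero_ne_one this
  simp [e₁, e₂, EuclideanSpace.inner_single_left, h]

lemma rot_e₁ (y : S N) : rot y e₁ = (y : E N) := by
  have hy : ‖(y : E N)‖ = 1 := by simp
  unfold rot
  split_ifs with h
  · rw [LinearIsometryEquiv.trans_apply,
      Submodule.reflection_orthogonalComplement_singleton_eq_neg,
      Submodule.reflection_mem_subspace_eq_self, h]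
    rw [Submodule.mem_orthogonal_singleton_iff_inner_left, inner_neg_left, inner_e₁_e₂, neg_zero]
  · have := Submodule.reflection_sub (v := (y : E N)) (w := -e₁) (by rw [norm_neg, norm_e₁, hy])
    rw [LinearIsometryEquiv.trans_apply,
      Submodule.reflection_orthogonalComplement_singleton_eq_neg]
    simp only [sub_neg_eq_add, add_comm (y : E N)] at this
    rw [← this, Submodule.reflection_reflection]

lemma rot_of_orthogonal (y : S N) (hy : (y : E N) ≠ -e₁) (z : E N) (hz₁ : inner ℝ z e₁ = 0)
    (hz : inner ℝ z (y : E N) = 0) : rot y z = z := by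
  unfold rot
  rw [if_neg hy, LinearIsometryEquiv.trans_apply,
    Submodule.reflection_mem_subspace_eq_self (x := z), Submodule.reflection_mem_subspace_eq_self]
  · rw [Submodule.mem_orthogonal_singleton_iff_inner_left, inner_add_right, hz₁, hz, add_zero]
  · rwa [Submodule.mem_orthogonal_singleton_iff_inner_left]

lemma det_rot (y : S N) : LinearMap.det ((rot y).toLinearEquiv : E N →ₗ[ℝ] E N) = 1 := by
  have key : ∀ v : E N, v ≠ 0 → LinearMap.det
      ((Submodule.reflection (Submodule.span ℝ {v})ᗮ).toLinearEquiv : E N →ₗ[ℝ] E N) = -1 := by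
    intro v hv
    have := Submodule.det_reflection (K := (Submodule.span ℝ {v})ᗮ)
    rw [Submodule.orthogonal_orthogonal, finrank_span_singleton hv, pow_one] at this
    exact this
  have h₁ : (e₁ : E N) ≠ 0 := by
    rw [← norm_ne_zero_iff, norm_e₁]; exact one_ne_zero
  have h₂ : (e₂ : E N) ≠ 0 := by
    rw [← norm_ne_zero_iff, norm_e₂]; exact one_ne_zero
  unfold rot
  split_ifs with h
  · rw [LinearIsometryEquiv.toLinearEquiv_trans, LinearEquiv.coe_trans, LinearMap.det_comp,
      key _ h₁, key _ h₂]
    norm_num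
  · rw [LinearIsometryEquiv.toLinearEquiv_trans, LinearEquiv.coe_trans, LinearMap.det_comp,
      key _ h₁, key _ fun h' => h (eq_neg_of_add_eq_zero_right h')]
    norm_num

lemma angle_lt_iff (z : S N) {α : ℝ} (h0 : 0 ≤ α) (hπ : α ≤ Real.pi) :
    InnerProductGeometry.angle e₁ (z : E N) < α ↔ Real.cos α < inner ℝ (z : E N) e₁ := by
  have hz : ‖(z : E N)‖ = 1 := by simp
  have hc : Real.cos (InnerProductGeometry.angle e₁ (z : E N)) = inner ℝ (z : E N) e₁ := by
    rw [InnerProductGeometry.cos_angle, norm_e₁, hz, real_inner_comm]; simp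
  rw [← hc]
  exact (Real.strictAntiOn_cos.lt_iff_gt ⟨h0, hπ⟩
    ⟨InnerProductGeometry.angle_nonneg _ _, InnerProductGeometry.angle_le_pi _ _⟩).symm

lemma toSphere_level (c : ℝ) (h0 : 0 ≤ c) (h1 : c < 1) :
    (volume : Measure (E N)).toSphere {z : S N | inner ℝ (z : E N) e₁ = c} = 0 := by
  have hm : MeasurableSet {z : S N | inner ℝ (z : E N) e₁ = c} :=
    (isClosed_eq (by fun_prop) continuous_const).measurableSet
  rw [Measure.toSphere_apply' _ hm]
  have hnull : (volume : Measure (E N)) {w : E N | inner ℝ w e₁ = c * ‖w‖} = 0 := by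
    refine Measure.addHaar_eq_zero_of_disjoint_translates _
      (fun n : ℕ => ((1 : ℝ) / (n + 1)) • (e₁ : E N)) ?_ ?_
      (isClosed_eq (by fun_prop) (by fun_prop)).measurableSet
    · refine (Metric.isBounded_closedBall (x := (0 : E N)) (r := 1)).subset ?_
      rintro _ ⟨n, rfl⟩
      rw [mem_closedBall_zero_iff, norm_smul, norm_e₁, mul_one, Real.norm_of_nonneg (by positivity)]
      rw [div_le_one (by positivity)]
      linarith [Nat.cast_nonneg (α := ℝ) n]
    · intro m n hmn
      rw [Function.onFun, Set.disjoint_left]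
      rintro _ ⟨_, rfl, v, hv, rfl⟩ ⟨_, rfl, w, hw, hvw⟩
      apply hmn
      simp only [Set.mem_ofPred_eq] at hv hw hvw
      set a : ℝ := 1 / ((m : ℝ) + 1) with ha
      set b : ℝ := 1 / ((n : ℝ) + 1) with hb
      have hwv : w = v + (a - b) • (e₁ : E N) := by
        rw [sub_smul]
        have : w = (a • (e₁ : E N) + v) - b • (e₁ : E N) := by rw [← hvw]; abel
        rw [this]; abel
      have i1 : inner ℝ w e₁ = inner ℝ v e₁ + (a - b) := by
        rw [hwv, inner_add_left, inner_smul_left, real_inner_self_eq_norm_sq, norm_e₁]; simp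
      have i2 : ‖w‖ ^ 2 = ‖v‖ ^ 2 + 2 * (a - b) * inner ℝ v e₁ + (a - b) ^ 2 := by
        rw [hwv, norm_add_sq_real, inner_smul_right, norm_smul, norm_e₁, mul_one, Real.norm_eq_abs,
          sq_abs]
        ring
      have hab : a = b := by
        by_contra hne
        have hd : a - b ≠ 0 := sub_ne_zero.2 hne
        have hv0 : 0 ≤ inner ℝ v e₁ := by rw [hv]; positivity
        have hw0 : 0 ≤ inner ℝ w e₁ := by rw [hw]; positivity
        have hv2 : inner ℝ v e₁ ^ 2 = c ^ 2 * ‖v‖ ^ 2 := by rw [hv]; ring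
        have hw2 : inner ℝ w e₁ ^ 2 = c ^ 2 * ‖w‖ ^ 2 := by rw [hw]; ring
        rw [i2, i1] at hw2
        have hc2 : 0 < 1 - c ^ 2 := by nlinarith
        have e : (1 - c ^ 2) * ((a - b) * (2 * inner ℝ v e₁ + (a - b))) = 0 := by linarith
        rcases mul_eq_zero.1 e with e | e
        · exact hc2.ne' e
        rcases mul_eq_zero.1 e with e | e
        · exact hd e
        rw [i1] at hw0
        exact hd (by linarith)
      have hm0 : (0 : ℝ) < (m : ℝ) + 1 := by positivity
      have hn0 : (0 : ℝ) < (n : ℝ) + 1 := by positivity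
      rw [ha, hb, div_eq_div_iff hm0.ne' hn0.ne'] at hab
      have : (m : ℝ) = n := by linarith
      exact_mod_cast this
  refine mul_eq_zero_of_right _ (measure_mono_null ?_ hnull)
  rintro _ ⟨r, hr, _, ⟨z, hz, rfl⟩, rfl⟩
  have hz1 : ‖(z : E N)‖ = 1 := by simp
  simp only [Set.mem_ofPred_eq] at hz ⊢
  rw [inner_smul_left, hz, norm_smul, hz1, Real.norm_of_nonneg hr.1.le]
  simp [mul_comm]

/-- For `2 ≤ p` there is an aperture angle. -/
lemma exists_isApertureAngle {p : ℝ} (hp : 2 ≤ p) : ∃ α, IsApertureAngle N p α := by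
  classical
  set σ := (volume : Measure (E N)).toSphere with hσ
  let A : S N → ℝ := fun z => inner ℝ (z : E N) e₁
  let B : S N → ℝ := fun z => inner ℝ (z : E N) e₂
  have hA : Continuous A := by fun_prop
  have hB : Continuous B := by fun_prop
  have hint : ∀ f : S N → ℝ, Continuous f → Integrable f σ := fun f hf =>
    hf.integrable_of_hasCompactSupport (HasCompactSupport.of_compactSpace f)
  let h : S N → ℝ := fun z => A z ^ 2 - (p - 1) * B z ^ 2
  have hh : Continuous h := by fun_prop
  have hangle : Continuous fun z : S N => InnerProductGeometry.angle e₁ (z : E N) := by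
    unfold InnerProductGeometry.angle
    have : ∀ z : S N, ‖(e₁ : E N)‖ * ‖(z : E N)‖ ≠ 0 := fun z => by simp [norm_e₁]
    fun_prop (disch := assumption)
  have hcapo : ∀ α, IsOpen (cap N α) := fun α => isOpen_lt hangle continuous_const
  have hcap : ∀ α, MeasurableSet (cap N α) := fun α => (hcapo α).measurableSet
  have hAB : ∀ z, A z ^ 2 + B z ^ 2 ≤ 1 := by
    intro z
    have hz : ‖(z : E N)‖ = 1 := by simp
    have hw := sq_nonneg ‖(z : E N) - (A z • (e₁ : E N) + B z • (e₂ : E N))‖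
    rw [norm_sub_sq_real, norm_add_sq_real, inner_add_right, inner_smul_right, inner_smul_right,
      inner_smul_left, inner_smul_right, inner_e₁_e₂, norm_smul, norm_smul, norm_e₁, norm_e₂, hz,
      mul_one, mul_one, Real.norm_eq_abs, Real.norm_eq_abs, sq_abs, sq_abs] at hw
    change 0 ≤ 1 ^ 2 - 2 * (A z * A z + B z * B z) + _ at hw
    linarith
  let g : ℝ → ℝ := fun α => ∫ z in cap N α, h z ∂σ
  -- continuity of `g`
  have hg : ContinuousOn g (Set.Ioc 0 (Real.pi / 2)) := by
    intro α hα
    refine ContinuousAt.continuousWithinAt ?_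
    have : g = fun α => ∫ z, (cap N α).indicator h z ∂σ := by
      funext β; exact (integral_indicator (hcap β)).symm
    rw [this]
    refine continuousAt_of_dominated (bound := fun z => ‖h z‖)
      (Filter.Eventually.of_forall fun β =>
        (hh.measurable.indicator (hcap β)).aestronglyMeasurable)
      (Filter.Eventually.of_forall fun β => Filter.Eventually.of_forall fun z =>
        norm_indicator_le_norm_self _ _) (hint h hh).norm ?_
    have hnull : σ {z : S N | A z = Real.cos α} = 0 := by
      refine toSphere_level _ (Real.cos_nonneg_of_neg_pi_div_two_le_of_le (by linarith [hα.1,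
        Real.pi_pos]) hα.2) ?_
      rw [← Real.cos_zero]
      exact Real.cos_lt_cos_of_nonneg_of_le_pi le_rfl (by linarith [hα.2, Real.pi_pos]) hα.1
    have hae : ∀ᵐ z ∂σ, A z ≠ Real.cos α := by rw [ae_iff]; simpa using hnull
    filter_upwards [hae] with z hz
    have hne : InnerProductGeometry.angle e₁ (z : E N) ≠ α := by
      intro he
      apply hz
      rw [← he, InnerProductGeometry.cos_angle, norm_e₁, norm_eq_of_mem_sphere, real_inner_comm]
      simp [A]
    rcases lt_or_gt_of_ne hne with hlt | hgt
    · refine (continuousAt_const (y := h z)).congr ?_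
      filter_upwards [lt_mem_nhds hlt] with β hβ
      exact (Set.indicator_of_mem (s := cap N β) hβ h).symm
    · refine (continuousAt_const (y := (0 : ℝ))).congr ?_
      filter_upwards [gt_mem_nhds hgt] with β hβ
      exact (Set.indicator_of_notMem (s := cap N β) (not_lt.2 hβ.le) h).symm
  -- small angles
  obtain ⟨a, ha0, ha1, ha⟩ : ∃ a : ℝ, 0 < a ∧ a ≤ Real.pi / 2 ∧
      0 ≤ Real.cos a ^ 2 - (p - 1) * Real.sin a ^ 2 := by
    have hc : Continuous fun a : ℝ => Real.cos a ^ 2 - (p - 1) * Real.sin a ^ 2 := by fun_prop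
    have h0 : ∀ᶠ a in nhdsWithin (0 : ℝ) (Set.Ioi 0),
        0 < Real.cos a ^ 2 - (p - 1) * Real.sin a ^ 2 :=
      nhdsWithin_le_nhds (hc.continuousAt.eventually (lt_mem_nhds (by simp)))
    have h1 : ∀ᶠ a in nhdsWithin (0 : ℝ) (Set.Ioi 0), a ∈ Set.Ioo 0 (Real.pi / 2) :=
      Ioo_mem_nhdsGT (by positivity)
    obtain ⟨a, h2, h3⟩ := (h0.and h1).exists
    exact ⟨a, h3.1, h3.2.le, h2.le⟩
  have hga : 0 ≤ g a := by
    refine setIntegral_nonneg (hcap a) fun z hz => ?_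
    have hz' : Real.cos a < A z := (angle_lt_iff z ha0.le (by linarith [Real.pi_pos])).1 hz
    have hc : 0 ≤ Real.cos a :=
      Real.cos_nonneg_of_neg_pi_div_two_le_of_le (by linarith [Real.pi_pos]) ha1
    have hA2 : Real.cos a ^ 2 ≤ A z ^ 2 := by nlinarith
    have hB2 : B z ^ 2 ≤ Real.sin a ^ 2 := by nlinarith [hAB z, Real.sin_sq_add_cos_sq a]
    show 0 ≤ A z ^ 2 - (p - 1) * B z ^ 2
    nlinarith
  -- the right angle
  have hgpi : g (Real.pi / 2) ≤ 0 := by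
    have hsplit : g (Real.pi / 2) = (∫ z in cap N (Real.pi / 2), (A z ^ 2 - B z ^ 2) ∂σ)
        - ∫ z in cap N (Real.pi / 2), (p - 2) * B z ^ 2 ∂σ := by
      rw [← integral_sub ((hint _ (by fun_prop)).integrableOn) ((hint _ (by fun_prop)).integrableOn)]
      refine integral_congr_ae (Filter.Eventually.of_forall fun z => ?_)
      simp only [h]
      ring
    have hB0 : 0 ≤ ∫ z in cap N (Real.pi / 2), (p - 2) * B z ^ 2 ∂σ :=
      setIntegral_nonneg (hcap _) fun z _ => mul_nonneg (by linarith) (sq_nonneg _)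
    have hcapeq : cap N (Real.pi / 2) = {z | 0 < A z} := by
      ext z
      have := angle_lt_iff z (α := Real.pi / 2) (by positivity) (by linarith [Real.pi_pos])
      rw [Real.cos_pi_div_two] at this
      exact this
    let k : S N → ℝ := fun z => A z ^ 2 - B z ^ 2
    have hk : Continuous k := by fun_prop
    -- the antipodal map
    let ν : S N → S N := fun z => -z
    have hν : MeasurePreserving ν σ σ :=
      toSphere_preserving (LinearIsometryEquiv.neg ℝ) ν (by fun_prop) fun z => rfl
    have hAν : ∀ z, A (ν z) = -A z := fun z => by simp [A, ν, inner_neg_left]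
    have hBν : ∀ z, B (ν z) = -B z := fun z => by simp [B, ν, inner_neg_left]
    have hνe : MeasurableEmbedding ν := (Homeomorph.neg (S N)).measurableEmbedding
    have hneg : ∫ z in {z | A z < 0}, k z ∂σ = ∫ z in {z | 0 < A z}, k z ∂σ := by
      have := hν.setIntegral_preimage_emb hνe k {z | 0 < A z}
      rw [← this]
      have hs : ν ⁻¹' {z | 0 < A z} = {z | A z < 0} := by
        ext z; simp [hAν]
      rw [hs]
      refine integral_congr_ae (Filter.Eventually.of_forall fun z => ?_)
      simp [k, hAν, hBν]
    -- the exchange of the first two axes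
    let τ : E N ≃ₗᵢ[ℝ] E N := Submodule.reflection (Submodule.span ℝ {(e₁ : E N) - e₂})ᗮ
    have hτ1 : τ e₁ = e₂ := Submodule.reflection_sub (by rw [norm_e₁, norm_e₂])
    have hτ2 : τ e₂ = e₁ := by rw [← hτ1]; exact Submodule.reflection_reflection _ _
    let θ : S N → S N := fun z => ⟨τ z, by simp⟩
    have hθm : Measurable θ :=
      ((τ.continuous.comp continuous_subtype_val).subtype_mk _).measurable
    have hθ : MeasurePreserving θ σ σ := toSphere_preserving τ θ hθm fun z => rfl
    have hττ : ∀ x y : E N, inner ℝ (τ x) y = inner ℝ x (τ y) := fun x y => by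
      rw [← τ.inner_map_map (τ x) y]
      congr 1
      exact Submodule.reflection_reflection _ _
    have hAθ : ∀ z, A (θ z) = B z := fun z => by
      show inner ℝ (τ z) e₁ = inner ℝ (z : E N) e₂
      rw [hττ, hτ1]
    have hBθ : ∀ z, B (θ z) = A z := fun z => by
      show inner ℝ (τ z) e₂ = inner ℝ (z : E N) e₁
      rw [hττ, hτ2]
    have htot : ∫ z, k z ∂σ = 0 := by
      have h1 : ∫ z, k (θ z) ∂σ = ∫ z, k z ∂σ := by
        rw [← integral_map hθ.measurable.aemeasurable hk.aestronglyMeasurable, hθ.map_eq]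
      have h2 : ∫ z, k (θ z) ∂σ = - ∫ z, k z ∂σ := by
        rw [← integral_neg]
        refine integral_congr_ae (Filter.Eventually.of_forall fun z => ?_)
        simp [k, hAθ, hBθ]
      linarith
    have hmp : MeasurableSet {z | 0 < A z} := (isOpen_lt continuous_const hA).measurableSet
    have hmn : MeasurableSet {z | A z < 0} := (isOpen_lt hA continuous_const).measurableSet
    have hcompl : ∫ z in {z | 0 < A z}ᶜ, k z ∂σ = ∫ z in {z | A z < 0}, k z ∂σ := by
      refine setIntegral_congr_set ?_
      have hae : ∀ᵐ z ∂σ, A z ≠ 0 := by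
        rw [ae_iff]; simpa using toSphere_level (N := N) 0 le_rfl one_pos
      filter_upwards [hae] with z hz
      simp only [eq_iff_iff]
      show ¬ (0 < A z) ↔ A z < 0
      rw [not_lt]
      exact ⟨fun h => lt_of_le_of_ne h hz, le_of_lt⟩
    have hsum := integral_add_compl hmp (hint k hk)
    rw [hcompl, hneg, htot] at hsum
    have hk0 : ∫ z in cap N (Real.pi / 2), (A z ^ 2 - B z ^ 2) ∂σ = 0 := by
      rw [hcapeq]
      show ∫ z in {z | 0 < A z}, k z ∂σ = 0
      linarith
    rw [hsplit, hk0]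
    linarith
  obtain ⟨α, hα, hgα⟩ : ∃ α ∈ Set.Icc a (Real.pi / 2), g α = 0 :=
    intermediate_value_Icc' ha1 (hg.mono fun x hx => ⟨ha0.trans_le hx.1, hx.2⟩) ⟨hgpi, hga⟩
  have hα0 : 0 < α := ha0.trans_le hα.1
  refine ⟨α, hα0, hα.2, ?_⟩
  have hpos : 0 < ∫ z in cap N α, B z ^ 2 ∂σ := by
    rw [setIntegral_pos_iff_support_of_nonneg_ae
      (Filter.Eventually.of_forall fun z => sq_nonneg _) (hint _ (by fun_prop)).integrableOn]
    have hU : IsOpen (Function.support (fun z => B z ^ 2) ∩ cap N α) :=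
      (Continuous.isOpen_support (by fun_prop)).inter (hcapo α)
    refine hU.measure_pos σ ?_
    set t := α / 2 with ht
    have ht0 : 0 < t := by positivity
    have htπ : t < Real.pi := by linarith [hα.2, Real.pi_pos]
    have e21 : inner ℝ (e₂ : E N) e₁ = 0 := by rw [real_inner_comm, inner_e₁_e₂]
    let w : E N := Real.cos t • (e₁ : E N) + Real.sin t • (e₂ : E N)
    have w1 : inner ℝ w e₁ = Real.cos t := by
      simp [w, inner_add_left, inner_smul_left, e21, norm_e₁]
    have w2 : inner ℝ w e₂ = Real.sin t := by
      simp [w, inner_add_left, inner_smul_left, inner_e₁_e₂, norm_e₂]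
    have hw : ‖w‖ = 1 := by
      have : ‖w‖ ^ 2 = 1 := by
        rw [← real_inner_self_eq_norm_sq]
        have : inner ℝ w w = Real.cos t * inner ℝ w e₁ + Real.sin t * inner ℝ w e₂ := by
          conv_lhs => rw [show w = Real.cos t • (e₁ : E N) + Real.sin t • (e₂ : E N) from rfl]
          rw [inner_add_right, inner_smul_right, inner_smul_right]
        rw [this, w1, w2]
        nlinarith [Real.sin_sq_add_cos_sq t]
      nlinarith [norm_nonneg w]
    refine ⟨⟨w, by simpa using hw⟩, ?_, ?_⟩
    · show B _ ^ 2 ≠ 0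
      refine pow_ne_zero _ ?_
      show inner ℝ w e₂ ≠ 0
      rw [w2]
      exact (Real.sin_pos_of_pos_of_lt_pi ht0 htπ).ne'
    · refine (angle_lt_iff _ hα0.le (by linarith [hα.2, Real.pi_pos])).2 ?_
      show Real.cos α < inner ℝ w e₁
      rw [w1]
      exact Real.cos_lt_cos_of_nonneg_of_le_pi ht0.le (by linarith [hα.2, Real.pi_pos])
        (by linarith)
  have heq : g α = (∫ z in cap N α, A z ^ 2 ∂σ) - (p - 1) * ∫ z in cap N α, B z ^ 2 ∂σ := by
    rw [← integral_const_mul,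
      ← integral_sub ((hint _ (by fun_prop)).integrableOn) ((hint _ (by fun_prop)).integrableOn)]
  rw [eq_div_iff hpos.ne']
  rw [hgα] at heq
  simp only [A, B] at heq
  linarith

lemma isApertureAngle_apertureAngle {p : ℝ} (hp : 2 ≤ p) :
    IsApertureAngle N p (apertureAngle N p) :=
  Classical.epsilon_spec (exists_isApertureAngle hp)

end ConeFacts

section Averaging

/-- The constant `C(N,s)`. -/
noncomputable def cNs (N : ℕ) (s : ℝ) : ℝ :=
  4 ^ s * s * Real.Gamma (N / 2 + s) / (Real.pi ^ ((N : ℝ) / 2) * Real.Gamma (1 - s))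

/-- The measure `dμ(z) = C(N,s) |z|^{-N-2s} dz` on `ℝᴺ`. -/
noncomputable def fracMeasure (N : ℕ) (s : ℝ) : Measure (E N) :=
  volume.withDensity fun z => ENNReal.ofReal (cNs N s / ‖z‖ ^ ((N : ℝ) + 2 * s))

variable {N : ℕ} [N.AtLeastTwo]

/-- The average `⨍_{T_p^{ε,∞}(y)} u(x+z) dμ(z)`. -/
noncomputable def coneAverage (p s ε : ℝ) (u : E N → ℝ) (x : E N) (y : S N) : ℝ :=
  ⨍ z in cone p ε (y : E N), u (x + z) ∂(fracMeasure N s)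

/-- The averaging operator `𝓐_ε`. -/
noncomputable def avgOp (p s ε : ℝ) (u : E N → ℝ) (x : E N) : ℝ :=
  ((⨆ y : S N, coneAverage p s ε u x y) + ⨅ y : S N, coneAverage p s ε u x y) / 2

/-- `u` is a bounded Borel solution of the dynamic programming principle `(DPP)_ε` in the
set `D` with the exterior data `F`. -/
structure IsDPPSolution (p s ε : ℝ) (D : Set (E N)) (F u : E N → ℝ) : Prop where
  measurable : Measurable u
  bounded : ∃ C : ℝ, ∀ x, |u x| ≤ C
  eq_avgOp : ∀ x ∈ D, u x = avgOp p s ε u x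
  eq_data : ∀ x ∉ D, u x = F x

end Averaging

section Game

variable {N : ℕ} [N.AtLeastTwo]

/-- The outcomes of one turn: a point of `T_p^{1,∞}` and the outcome of the coin toss, which is
`0` if the direction of Player I is used and `1` if that of Player II is used. -/
abbrev Turn (N : ℕ) [N.AtLeastTwo] (p : ℝ) : Type :=
  ↥(cone p 1 (e₁ : E N)) × Fin 2

/-- The law of one turn: the normalized measure on `T_p^{1,∞}`, times the fair coin. -/
noncomputable def turnMeasure (N : ℕ) [N.AtLeastTwo] (p s : ℝ) : Measure (Turn N p) :=
  ((ProbabilityTheory.cond (fracMeasure N s) (cone p 1 e₁)).comap Subtype.val).prod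
    (ProbabilityTheory.uniformOn Set.univ)

lemma isOpen_cone (p : ℝ) {a : ℝ} (ha : 0 ≤ a) {y : E N} (hy : y ≠ 0) : IsOpen (cone p a y) := by
  have h : ContinuousOn (fun z : E N => InnerProductGeometry.angle y z) {z | a < ‖z‖} := by
    intro z hz
    have hz0 : z ≠ 0 := norm_pos_iff.1 (lt_of_le_of_lt ha hz)
    exact ((InnerProductGeometry.continuousAt_angle (x := (y, z)) hy hz0).comp
      (by fun_prop : ContinuousAt (fun z : E N => (y, z)) z)).continuousWithinAt
  have := h.isOpen_inter_preimage (isOpen_lt continuous_const continuous_norm)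
    (isOpen_Iio (a := apertureAngle N p))
  rwa [Set.inter_comm] at this

/-- For `2 ≤ p` and `0 < s < 1`, the law of one turn is a probability measure. -/
lemma isProbabilityMeasure_turnMeasure {p s : ℝ} (hp : 2 ≤ p) (hs0 : 0 < s) (hs1 : s < 1) :
    IsProbabilityMeasure (turnMeasure N p s) := by
  have he : (e₁ : E N) ≠ 0 := by rw [← norm_ne_zero_iff, norm_e₁]; exact one_ne_zero
  have ho := isOpen_cone (N := N) p zero_le_one he
  have hm := ho.measurableSet
  have hc : 0 < cNs N s := by
    have h1 := Real.Gamma_pos_of_pos (s := (N : ℝ) / 2 + s) (by positivity)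
    have h2 := Real.Gamma_pos_of_pos (s := 1 - s) (by linarith)
    unfold cNs
    positivity
  have hdm : Measurable fun z : E N => ENNReal.ofReal (cNs N s / ‖z‖ ^ ((N : ℝ) + 2 * s)) := by
    fun_prop
  have hpos : fracMeasure N s (cone p 1 e₁) ≠ 0 := by
    rw [fracMeasure, withDensity_apply _ hm]
    refine (setLIntegral_pos_iff hdm |>.2 ?_).ne'
    have hsub : cone p 1 (e₁ : E N) ⊆ Function.support
        (fun z : E N => ENNReal.ofReal (cNs N s / ‖z‖ ^ ((N : ℝ) + 2 * s))) := by
      intro z hz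
      have hz0 : 0 < ‖z‖ := zero_lt_one.trans hz.2
      exact (ENNReal.ofReal_pos.2 (by positivity)).ne'
    rw [Set.inter_eq_right.2 hsub]
    refine ho.measure_pos _ ⟨(2 : ℝ) • e₁, ?_, ?_⟩
    · rw [InnerProductGeometry.angle_smul_right_of_pos _ _ two_pos,
        InnerProductGeometry.angle_self he]
      exact (isApertureAngle_apertureAngle hp).1
    · rw [norm_smul, norm_e₁]; norm_num
  have hfin : fracMeasure N s (cone p 1 e₁) ≠ ⊤ := by
    rw [fracMeasure, withDensity_apply _ hm]
    have hr : (Module.finrank ℝ (E N) : ℝ) < (N : ℝ) + 2 * s := by simp [hs0]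
    have hI := finite_integral_one_add_norm (μ := (volume : Measure (E N))) hr
    have hle : ∫⁻ z in cone p 1 (e₁ : E N),
        ENNReal.ofReal (cNs N s / ‖z‖ ^ ((N : ℝ) + 2 * s)) ≤
        ∫⁻ z : E N, ENNReal.ofReal (cNs N s * 2 ^ ((N : ℝ) + 2 * s)) *
          ENNReal.ofReal ((1 + ‖z‖) ^ (-((N : ℝ) + 2 * s))) := by
      refine (setLIntegral_mono' hm fun z hz => ?_).trans (setLIntegral_le_lintegral _ _)
      have hz1 : 1 < ‖z‖ := hz.2
      have hz0 : 0 < ‖z‖ := zero_lt_one.trans hz1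
      rw [← ENNReal.ofReal_mul (by positivity)]
      refine ENNReal.ofReal_le_ofReal ?_
      rw [Real.rpow_neg (by positivity), ← div_eq_mul_inv, div_le_div_iff₀ (by positivity)
        (by positivity), mul_assoc, ← Real.mul_rpow (by norm_num) hz0.le]
      gcongr
      linarith
    refine (hle.trans_lt ?_).ne
    rw [lintegral_const_mul _ (by fun_prop)]
    exact ENNReal.mul_lt_top ENNReal.ofReal_lt_top hI
  have h1 := ProbabilityTheory.cond_isProbabilityMeasure_of_finite hpos hfin
  have h2 : IsProbabilityMeasure ((ProbabilityTheory.cond (fracMeasure N s)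
      (cone p 1 e₁)).comap (Subtype.val : ↥(cone p 1 (e₁ : E N)) → E N)) := by
    refine ⟨?_⟩
    rw [(MeasurableEmbedding.subtype_coe hm).comap_apply, Set.image_univ, Subtype.range_coe]
    exact ProbabilityTheory.cond_apply_self hpos hfin
  have h3 : IsProbabilityMeasure (ProbabilityTheory.uniformOn (Set.univ : Set (Fin 2))) :=
    ProbabilityTheory.isProbabilityMeasure_uniformOn Set.finite_univ Set.univ_nonempty
  unfold turnMeasure
  infer_instance

/-- The law of an infinite sequence of independent turns (turn number `n` is `ω (n - 1)`). -/
noncomputable def gameMeasure (N : ℕ) [N.AtLeastTwo] (p s : ℝ) : Measure (ℕ → Turn N p) :=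
  Measure.infinitePi fun _ => turnMeasure N p s

/-- The finite histories `H_n = ℝᴺ × (ℝᴺ × Ω₁)ⁿ`: the initial position, then for each of the
turns played the new position together with the outcome of that turn. -/
abbrev History (N : ℕ) [N.AtLeastTwo] (p : ℝ) (n : ℕ) : Type :=
  E N × (Fin n → E N × Turn N p)

/-- The last position recorded in a history. -/
def History.last {p : ℝ} : {n : ℕ} → History N p n → E N
  | 0, h => h.1
  | n + 1, h => (h.2 (Fin.last n)).1

/-- A strategy: Borel choices of a unit vector, one for each length of the history. -/
structure Strategy (N : ℕ) [N.AtLeastTwo] (p : ℝ) where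
  toFun : (n : ℕ) → History N p n → S N
  measurable : ∀ n, Measurable (toFun n)

variable {p : ℝ}

/-- The position after one more turn with outcome `t`, given the history `h`. -/
noncomputable def nextPosition (ε : ℝ) (σI σII : Strategy N p) {n : ℕ} (h : History N p n)
    (t : Turn N p) : E N :=
  h.last + ε • rot (if t.2 = 0 then σI.toFun n h else σII.toFun n h) (t.1 : E N)

/-- The history of the game started at `x` after `n` turns. -/
noncomputable def history (ε : ℝ) (x : E N) (σI σII : Strategy N p) :
    (n : ℕ) → (ℕ → Turn N p) → History N p n
  | 0, _ => (x, Fin.elim0)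
  | n + 1, ω =>
    let h := history ε x σI σII n ω
    (x, Fin.snoc h.2 (nextPosition ε σI σII h (ω n), ω n))

/-- The position `X_n` of the game started at `x`. -/
noncomputable def position (ε : ℝ) (x : E N) (σI σII : Strategy N p) (n : ℕ)
    (ω : ℕ → Turn N p) : E N :=
  (history ε x σI σII n ω).last

/-- The stopping time `τ = min {n ≥ 1 ; X_n ∉ D}`, with value `⊤` if there is no such `n`. -/
noncomputable def exitTime (ε : ℝ) (D : Set (E N)) (x : E N) (σI σII : Strategy N p) :
    (ℕ → Turn N p) → WithTop ℕ :=
  hittingAfter (position ε x σI σII) Dᶜ 1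

/-- The expected payoff `𝔼[F ∘ X_τ]`. -/
noncomputable def expectedPayoff (s ε : ℝ) (D : Set (E N)) (F : E N → ℝ) (x : E N)
    (σI σII : Strategy N p) : ℝ :=
  ∫ ω, F (stoppedValue (position ε x σI σII) (exitTime ε D x σI σII) ω) ∂(gameMeasure N p s)

/-- The game value `u_I^ε(x) = sup_{σ_I} inf_{σ_II} 𝔼[F ∘ X_τ]`. -/
noncomputable def valueI (p s ε : ℝ) (D : Set (E N)) (F : E N → ℝ) (x : E N) : ℝ :=
  ⨆ σI : Strategy N p, ⨅ σII : Strategy N p, expectedPayoff s ε D F x σI σII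

/-- The game value `u_II^ε(x) = inf_{σ_II} sup_{σ_I} 𝔼[F ∘ X_τ]`. -/
noncomputable def valueII (p s ε : ℝ) (D : Set (E N)) (F : E N → ℝ) (x : E N) : ℝ :=
  ⨅ σII : Strategy N p, ⨆ σI : Strategy N p, expectedPayoff s ε D F x σI σII

end Game

end NonlocalTug

/-! The kernel of `μ` is homogeneous and rotation invariant, so averaging over `T_p^{ε,∞}(y)` is the
same as averaging `u (x + ε R_y z)` over one fixed probability, `jumpLaw` on `T_p^{1,∞}`
(`coneAverage_eq`). The averaging operator thus describes exactly one turn of the game.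

Since `D` is bounded and arbitrarily long jumps have positive probability, a jump from `D` lands in
`D` with probability at most some `r < 1`, whatever the direction. Among bounded functions equal to
`F` off `D`, the operator is therefore a contraction (`exists_avgOp_contraction`), which gives
existence and uniqueness of `u`. Borel measurability survives the supremum over directions because
the cone averages are lower semicontinuous in `y`: a dense sequence of directions suffices, and it
also yields Borel almost optimal selections.

The same `r` bounds the duration of the game (`exists_alive_le`). If Player II always plays an
almost minimizing direction, then `avgOp u` along the game, replaced by the payoff after the exit,
is a supermartingale up to an error `η` per turn. Running it for a fixed large number of turns
bounds the payoff (`expectedPayoff_le`). The bound for Player I follows by passing to `-F` and `-u`.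
As the exit is tested only from the first turn on, the value is `avgOp u` at every starting point,
and this equals `u` in `D`. -/

namespace NonlocalTug

/-! ### Scaling and rotation of the cones; measurability and semicontinuity of the cone averages. -/

section JumpLaw

variable {N : ℕ}

/-- The fractional measure is homogeneous under dilations composed with linear isometries. -/
lemma exists_map_fracMeasure_eq_smul (s : ℝ) {r : ℝ} (hr : 0 < r) :
    ∃ c : ENNReal, c ≠ 0 ∧ c ≠ ⊤ ∧ ∀ R : E N ≃ₗᵢ[ℝ] E N,
      (fracMeasure N s).map (fun z => r • R z) = c • fracMeasure N s := by
  set k : E N → ENNReal := fun z => ENNReal.ofReal (cNs N s / ‖z‖ ^ ((N : ℝ) + 2 * s)) with hk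
  have hkm : Measurable k := by fun_prop
  -- The total factor is `K * b = r ^ (2 * s)`: the density contributes `r ^ (N + 2 * s)`, the
  -- volume `r ^ (-N)`. It does not depend on `R`.
  set K : ENNReal := ENNReal.ofReal (r ^ ((N : ℝ) + 2 * s)) with hK
  set b : ENNReal := ENNReal.ofReal |(r ^ N)⁻¹| with hb
  refine ⟨K * b, mul_ne_zero ?_ ?_, ENNReal.mul_ne_top ENNReal.ofReal_ne_top ENNReal.ofReal_ne_top,
    ?_⟩
  · exact (ENNReal.ofReal_pos.2 (by positivity)).ne'
  · exact (ENNReal.ofReal_pos.2 (by positivity)).ne'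
  intro R
  have hφ : Measurable fun z : E N => r • R z := by fun_prop
  have hvol : (volume : Measure (E N)).map (fun z => r • R z) = b • volume := by
    have h := Measure.map_map (μ := (volume : Measure (E N)))
      (by fun_prop : Measurable fun z : E N => r • z) R.continuous.measurable
    rw [R.measurePreserving.map_eq, Measure.map_addHaar_smul _ hr.ne', finrank_euclideanSpace,
      Fintype.card_fin] at h
    exact h.symm
  have hkφ : ∀ z, k z = K * k (r • R z) := by
    intro z
    rw [hk, hK, ← ENNReal.ofReal_mul (by positivity)]
    rw [norm_smul, R.norm_map, Real.norm_of_nonneg hr.le, Real.mul_rpow hr.le (norm_nonneg _)]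
    have : r ^ ((N : ℝ) + 2 * s) ≠ 0 := (Real.rpow_pos_of_pos hr _).ne'
    rw [← div_div, div_right_comm, mul_div_cancel₀ _ this]
  ext A hA
  rw [Measure.map_apply hφ hA, Measure.smul_apply, fracMeasure, withDensity_apply _ hA,
    withDensity_apply _ (hφ hA)]
  calc ∫⁻ z in (fun z => r • R z) ⁻¹' A, k z
      = ∫⁻ z in (fun z => r • R z) ⁻¹' A, K * k (r • R z) :=
        lintegral_congr hkφ
    _ = K * ∫⁻ z in (fun z => r • R z) ⁻¹' A, k (r • R z) :=
        lintegral_const_mul _ (hkm.comp hφ)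
    _ = K * ∫⁻ z in A, k z ∂(volume.map fun z => r • R z) := by
        rw [setLIntegral_map hA hkm hφ]
    _ = (K * b) • ∫⁻ z in A, k z := by
        rw [hvol, Measure.restrict_smul, lintegral_smul_measure, smul_eq_mul, smul_eq_mul,
          mul_assoc]

variable [N.AtLeastTwo]

lemma e₁_ne_zero : (e₁ : E N) ≠ 0 := by
  rw [← norm_ne_zero_iff, norm_e₁]; exact one_ne_zero

lemma measurableSet_cone (p : ℝ) {a : ℝ} (ha : 0 ≤ a) (y : S N) :
    MeasurableSet (cone p a (y : E N)) :=
  (isOpen_cone p ha (ne_zero_of_mem_unit_sphere y)).measurableSet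

lemma measurableSet_cone_e₁ (p : ℝ) : MeasurableSet (cone p 1 (e₁ : E N)) :=
  (isOpen_cone p zero_le_one e₁_ne_zero).measurableSet

lemma preimage_cone (p : ℝ) {r : ℝ} (hr : 0 < r) (a : ℝ) (y : S N) :
    (fun z => r • rot y z) ⁻¹' cone p (r * a) (y : E N) = cone p a e₁ := by
  ext z
  simp only [cone, Set.mem_preimage, Set.mem_ofPred_eq]
  rw [InnerProductGeometry.angle_smul_right_of_pos _ _ hr, ← rot_e₁ y,
    show InnerProductGeometry.angle (rot y e₁) (rot y z) = InnerProductGeometry.angle e₁ z from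
      (rot y).toLinearIsometry.angle_map e₁ z, norm_smul, LinearIsometryEquiv.norm_map,
    Real.norm_of_nonneg hr.le, mul_lt_mul_iff_right₀ hr]

/-- The normalized fractional measure on the cone `T_p^{1,∞}`. -/
noncomputable def jumpLaw (N : ℕ) [N.AtLeastTwo] (p s : ℝ) : Measure (E N) :=
  ProbabilityTheory.cond (fracMeasure N s) (cone p 1 e₁)

/-- A mass equal to `0` or `⊤` would make the conditional measure vanish (in the second case because
`⊤⁻¹ = 0`), and the law of one turn would not have mass one. -/
lemma fracMeasure_cone_ne {p s : ℝ} (hp : 2 ≤ p) (hs0 : 0 < s) (hs1 : s < 1) :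
    fracMeasure N s (cone p 1 e₁) ≠ 0 ∧ fracMeasure N s (cone p 1 e₁) ≠ ⊤ := by
  have h := (isProbabilityMeasure_turnMeasure (N := N) hp hs0 hs1).measure_univ
  constructor
  · intro h0
    rw [turnMeasure, ProbabilityTheory.cond, Measure.restrict_eq_zero.2 h0] at h
    simp at h
  · intro h0
    rw [turnMeasure, ProbabilityTheory.cond, h0] at h
    simp at h

lemma isProbabilityMeasure_jumpLaw {p s : ℝ} (hp : 2 ≤ p) (hs0 : 0 < s) (hs1 : s < 1) :
    IsProbabilityMeasure (jumpLaw N p s) :=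
  have h := fracMeasure_cone_ne (N := N) hp hs0 hs1
  ProbabilityTheory.cond_isProbabilityMeasure_of_finite h.1 h.2

/-- The factor `c` serves all directions at once, so cones with the same truncation radius have the
same mass. -/
lemma exists_fracMeasure_cone {p : ℝ} (s : ℝ) {r : ℝ} (hr : 0 < r) :
    ∃ c : ENNReal, c ≠ 0 ∧ c ≠ ⊤ ∧ ∀ y : S N,
      (fracMeasure N s).map (fun z => r • rot y z) = c • fracMeasure N s ∧
      fracMeasure N s (cone p 1 e₁) = c * fracMeasure N s (cone p r (y : E N)) := by
  obtain ⟨c, h0, ht, hc⟩ := exists_map_fracMeasure_eq_smul (N := N) s hr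
  refine ⟨c, h0, ht, fun y => ⟨hc _, ?_⟩⟩
  rw [← smul_eq_mul, ← Measure.smul_apply, ← hc (rot y), Measure.map_apply (by fun_prop)
    (measurableSet_cone p hr.le y)]
  have := preimage_cone p hr 1 y
  rw [mul_one] at this
  rw [this]

/-- The map carries one cone onto the other, and the homogeneity factor cancels in the
normalization. -/
lemma cond_fracMeasure_cone {p : ℝ} (s : ℝ) {r : ℝ} (hr : 0 < r) (y : S N) :
    ProbabilityTheory.cond (fracMeasure N s) (cone p r (y : E N)) =
      (jumpLaw N p s).map fun z => r • rot y z := by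
  obtain ⟨c, h0, ht, h⟩ := exists_fracMeasure_cone (N := N) (p := p) s hr
  obtain ⟨hc, hcone⟩ := h y
  have hφ : Measurable fun z : E N => r • rot y z := by fun_prop
  have hpre := preimage_cone p hr 1 y
  rw [mul_one] at hpre
  rw [jumpLaw, ProbabilityTheory.cond, ProbabilityTheory.cond, Measure.map_smul, ← hpre,
    ← Measure.restrict_map hφ (measurableSet_cone p hr.le y), hc, hpre, hcone,
    Measure.restrict_smul, smul_smul, ENNReal.mul_inv (Or.inl h0) (Or.inl ht), mul_comm,
    ← mul_assoc, ENNReal.mul_inv_cancel h0 ht, one_mul]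

lemma coneAverage_eq {p : ℝ} (s : ℝ) {ε : ℝ} (hε : 0 < ε) {u : E N → ℝ} (hu : Measurable u)
    (x : E N) (y : S N) :
    coneAverage p s ε u x y = ∫ z, u (x + ε • rot y z) ∂jumpLaw N p s := by
  have h : coneAverage p s ε u x y =
      ∫ z, u (x + z) ∂ProbabilityTheory.cond (fracMeasure N s) (cone p ε (y : E N)) := by
    rw [coneAverage, average_eq', ProbabilityTheory.cond, Measure.restrict_apply_univ]
  rw [h, cond_fracMeasure_cone s hε, integral_map (by fun_prop)]
  exact (hu.comp (measurable_const_add x)).aestronglyMeasurable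

/-- Arbitrarily long jumps have positive probability. -/
lemma jumpLaw_norm_le_lt_one {p s : ℝ} (hp : 2 ≤ p) (hs0 : 0 < s) (hs1 : s < 1) (d : ℝ) :
    jumpLaw N p s {z | ‖z‖ ≤ d} < 1 := by
  have := isProbabilityMeasure_jumpLaw (N := N) hp hs0 hs1
  have hne := fracMeasure_cone_ne (N := N) hp hs0 hs1
  have hm : MeasurableSet {z : E N | ‖z‖ ≤ d} := (isClosed_le (by fun_prop) (by fun_prop)).measurableSet
  set r := max 1 d with hr
  have hr0 : 0 < r := lt_of_lt_of_le one_pos (le_max_left _ _)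
  let y : S N := ⟨e₁, by simp [norm_e₁]⟩
  -- By homogeneity the cone truncated at `r ≥ 1` keeps a positive mass, and all its points have
  -- norm greater than `d`.
  have hpos : jumpLaw N p s (cone p r (e₁ : E N)) ≠ 0 := by
    obtain ⟨c, -, -, hcone⟩ := exists_fracMeasure_cone (N := N) (p := p) s hr0
    have hsub : cone p r (e₁ : E N) ⊆ cone p 1 e₁ :=
      fun z hz => ⟨hz.1, (le_max_left _ _).trans_lt hz.2⟩
    rw [jumpLaw, ProbabilityTheory.cond_apply (measurableSet_cone_e₁ p),
      Set.inter_eq_right.2 hsub]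
    refine mul_ne_zero (ENNReal.inv_ne_zero.2 hne.2) fun h => hne.1 ?_
    rw [(hcone y).2]
    exact mul_eq_zero_of_right _ h
  refine lt_of_le_of_ne prob_le_one fun h => hpos ?_
  refine measure_mono_null ?_ ((prob_compl_eq_zero_iff hm).2 h)
  intro z hz hzd
  exact absurd (hz.2.trans_le hzd) (not_lt.2 (le_max_right _ _))

/-- The reflection in the hyperplane orthogonal to `v` is an explicit expression, jointly measurable
in `v` and the point. The exceptional direction `-e₁` is split off as a measurable case. -/
lemma measurable_rot : Measurable fun q : S N × E N => rot q.1 q.2 := by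
  have key : ∀ v w : E N, Submodule.reflection (Submodule.span ℝ {v})ᗮ w =
      w - (2 * (inner ℝ v w / ‖v‖ ^ 2)) • v := by
    intro v w
    rw [Submodule.reflection_orthogonal_apply, Submodule.reflection_singleton_apply]
    simp [two_mul, two_smul, add_smul]
  classical
  have h : (fun q : S N × E N => rot q.1 q.2) = fun q =>
      if (q.1 : E N) = -e₁ then
        Submodule.reflection (Submodule.span ℝ {(e₂ : E N)})ᗮ
          (Submodule.reflection (Submodule.span ℝ {(e₁ : E N)})ᗮ q.2)
      else Submodule.reflection (Submodule.span ℝ {(e₁ : E N) + (q.1 : E N)})ᗮ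
        (Submodule.reflection (Submodule.span ℝ {(e₁ : E N)})ᗮ q.2) := by
    funext q
    unfold rot
    split_ifs <;> rfl
  rw [h]
  simp only [key]
  refine Measurable.ite ?_ (by fun_prop) (by fun_prop)
  exact measurableSet_eq_fun (by fun_prop) measurable_const

lemma measurable_coneAverage {p s : ℝ} (hp : 2 ≤ p) (hs0 : 0 < s) (hs1 : s < 1) {ε : ℝ}
    (hε : 0 < ε) {u : E N → ℝ} (hu : Measurable u) (y : S N) :
    Measurable fun x => coneAverage p s ε u x y := by
  have := isProbabilityMeasure_jumpLaw (N := N) hp hs0 hs1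
  simp only [coneAverage_eq s hε hu]
  have : Measurable fun q : E N × E N => u (q.1 + ε • rot y q.2) := by fun_prop
  exact this.stronglyMeasurable.integral_prod_right'.measurable

/-- A change of sign exchanges suprema and infima, hence the roles of the two players. -/
lemma coneAverage_neg (p s ε : ℝ) (u : E N → ℝ) (x : E N) (y : S N) :
    coneAverage p s ε (fun z => -u z) x y = -coneAverage p s ε u x y := by
  simp only [coneAverage, average, integral_neg]

lemma abs_coneAverage_le {p s : ℝ} (hp : 2 ≤ p) (hs0 : 0 < s) (hs1 : s < 1) {ε : ℝ}
    (hε : 0 < ε) {u : E N → ℝ} (hu : Measurable u) {C : ℝ} (hC : ∀ x, |u x| ≤ C) (x : E N)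
    (y : S N) : |coneAverage p s ε u x y| ≤ C := by
  have := isProbabilityMeasure_jumpLaw (N := N) hp hs0 hs1
  rw [coneAverage_eq s hε hu, ← Real.norm_eq_abs]
  simpa using norm_integral_le_of_norm_le_const (μ := jumpLaw N p s)
    (f := fun z => u (x + ε • rot y z))
    (Filter.Eventually.of_forall fun z => hC (x + ε • rot y z))

/-- The averages over the cones are lower semicontinuous in the direction of the cone. -/
lemma lowerSemicontinuous_coneAverage {p s : ℝ} (hp : 2 ≤ p) (hs0 : 0 < s) (hs1 : s < 1) {ε : ℝ}
    (hε : 0 < ε) {u : E N → ℝ} (hu : Measurable u) {C : ℝ} (hC : ∀ x, |u x| ≤ C) (x : E N) :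
    LowerSemicontinuous fun y => coneAverage p s ε u x y := by
  set μ := fracMeasure N s
  obtain ⟨c, h0, ht, hc⟩ := exists_fracMeasure_cone (N := N) (p := p) s hε
  have hne := fracMeasure_cone_ne (N := N) hp hs0 hs1
  set m : ENNReal := c⁻¹ * μ (cone p 1 e₁) with hm
  have hmy : ∀ y : S N, μ (cone p ε (y : E N)) = m := by
    intro y
    rw [hm, (hc y).2, ← mul_assoc, ENNReal.inv_mul_cancel h0 ht, one_mul]
  have hm0 : m ≠ 0 := mul_ne_zero (ENNReal.inv_ne_zero.2 ht) hne.1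
  have hmt : m ≠ ⊤ := ENNReal.mul_ne_top (ENNReal.inv_ne_top.2 h0) hne.2
  have hmr : 0 < m.toReal := ENNReal.toReal_pos hm0 hmt
  have hcm : ∀ y : S N, MeasurableSet (cone p ε (y : E N)) := measurableSet_cone p hε.le
  -- Adding `C` makes the integrand nonnegative, so that its integral decreases when the domain
  -- shrinks; the common mass `m` makes the correction independent of the direction.
  let g : E N → ℝ := fun z => u (x + z) + C
  have hgm : Measurable g := by fun_prop
  have hg0 : ∀ z, 0 ≤ g z := fun z => by
    have := abs_le.1 (hC (x + z))
    simp only [g]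
    linarith [this.1]
  have hgb : ∀ z, ‖g z‖ ≤ 2 * C := fun z => by
    rw [Real.norm_of_nonneg (hg0 z)]
    have := abs_le.1 (hC (x + z))
    simp only [g]
    linarith [this.2]
  have hfin : ∀ y : S N, IsFiniteMeasure (μ.restrict (cone p ε (y : E N))) := fun y =>
    ⟨by rw [Measure.restrict_apply_univ, hmy]; exact hmt.lt_top⟩
  have hgi : ∀ y : S N, IntegrableOn g (cone p ε (y : E N)) μ := fun y =>
    Integrable.of_bound hgm.aestronglyMeasurable (2 * C) (Filter.Eventually.of_forall hgb)
  have hf : ∀ y : S N, coneAverage p s ε u x y =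
      m.toReal⁻¹ * (∫ z in cone p ε (y : E N), g z ∂μ) - C := by
    intro y
    have h1 : ∫ z in cone p ε (y : E N), u (x + z) ∂μ =
        (∫ z in cone p ε (y : E N), g z ∂μ) - C * m.toReal := by
      have : ∫ _ in cone p ε (y : E N), C ∂μ = C * m.toReal := by
        rw [setIntegral_const, measureReal_def, hmy, smul_eq_mul, mul_comm]
      rw [← this, ← integral_sub (hgi y) (integrable_const _)]
      simp [g]
    rw [coneAverage, setAverage_eq, h1, measureReal_def, hmy, smul_eq_mul, mul_sub,
      mul_comm C, inv_mul_cancel_left₀ hmr.ne']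
  have hG : LowerSemicontinuous fun y : S N => ∫ z in cone p ε (y : E N), g z ∂μ := by
    intro y a ha
    -- On the fixed cone around `y`, each point also belongs to all cones around nearby directions,
    -- because the angle condition is strict.
    have hlim : Filter.Tendsto
        (fun y' : S N => ∫ z in cone p ε (y : E N), (cone p ε (y' : E N)).indicator g z ∂μ)
        (nhds y) (nhds (∫ z in cone p ε (y : E N), g z ∂μ)) := by
      refine tendsto_integral_filter_of_dominated_convergence (fun _ => 2 * C)
        (Filter.Eventually.of_forall fun y' =>
          (hgm.indicator (hcm y')).aestronglyMeasurable)
        (Filter.Eventually.of_forall fun y' => Filter.Eventually.of_forall fun z =>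
          (norm_indicator_le_norm_self _ _).trans (hgb z)) (integrable_const _) ?_
      filter_upwards [ae_restrict_mem (hcm y)] with z hz
      refine tendsto_const_nhds.congr' ?_
      have hz0 : z ≠ 0 := norm_pos_iff.1 (hε.trans hz.2)
      have hcont : ContinuousAt (fun y' : S N => InnerProductGeometry.angle (y' : E N) z) y :=
        (InnerProductGeometry.continuousAt_angle (x := ((y : E N), z))
          (ne_zero_of_mem_unit_sphere y) hz0).comp
          (f := fun y' : S N => ((y' : E N), z)) (by fun_prop)
      filter_upwards [hcont.eventually (gt_mem_nhds hz.1)] with y' hy'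
      exact (Set.indicator_of_mem (s := cone p ε (y' : E N)) ⟨hy', hz.2⟩ g).symm
    filter_upwards [hlim.eventually (lt_mem_nhds ha)] with y' hy'
    refine hy'.trans_le ?_
    -- The part of the new cone lying outside the old one contributes a nonnegative amount, which is
    -- dropped.
    rw [setIntegral_indicator (hcm y')]
    exact setIntegral_mono_set (hgi y') (Filter.Eventually.of_forall hg0)
      Set.inter_subset_right.eventuallyLE
  intro y a ha
  simp only [hf] at ha ⊢
  have ha' : m.toReal * (a + C) < ∫ z in cone p ε (y : E N), g z ∂μ := by
    rw [← lt_inv_mul_iff₀ hmr]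
    linarith
  filter_upwards [hG y _ ha'] with y' hy'
  rw [gt_iff_lt, ← lt_inv_mul_iff₀ hmr] at hy'
  linarith

end JumpLaw
-- The averaging operator: measurability, almost optimal directions, contraction, fixed point.
section DPP

variable {N : ℕ} [N.AtLeastTwo]

instance nonempty_sphere : Nonempty (S N) := ⟨⟨e₁, by simp [norm_e₁]⟩⟩

lemma bddAbove_coneAverage {p s : ℝ} (hp : 2 ≤ p) (hs0 : 0 < s) (hs1 : s < 1) {ε : ℝ}
    (hε : 0 < ε) {u : E N → ℝ} (hu : Measurable u) (hb : ∃ C : ℝ, ∀ x, |u x| ≤ C) (x : E N) :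
    BddAbove (Set.range fun y : S N => coneAverage p s ε u x y) := by
  obtain ⟨C, hC⟩ := hb
  refine ⟨C, ?_⟩
  rintro _ ⟨y, rfl⟩
  exact (abs_le.1 (abs_coneAverage_le hp hs0 hs1 hε hu hC x y)).2

lemma bddBelow_coneAverage {p s : ℝ} (hp : 2 ≤ p) (hs0 : 0 < s) (hs1 : s < 1) {ε : ℝ}
    (hε : 0 < ε) {u : E N → ℝ} (hu : Measurable u) (hb : ∃ C : ℝ, ∀ x, |u x| ≤ C) (x : E N) :
    BddBelow (Set.range fun y : S N => coneAverage p s ε u x y) := by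
  obtain ⟨C, hC⟩ := hb
  refine ⟨-C, ?_⟩
  rintro _ ⟨y, rfl⟩
  exact (abs_le.1 (abs_coneAverage_le hp hs0 hs1 hε hu hC x y)).1

lemma iSup_coneAverage_neg (p s ε : ℝ) (u : E N → ℝ) (x : E N) :
    ⨆ y : S N, coneAverage p s ε (fun z => -u z) x y = -⨅ y : S N, coneAverage p s ε u x y := by
  simp only [coneAverage_neg]
  -- Over `ℝ`, `sInf` is the negated `sSup` of the negated set, so no boundedness of `u` is needed.
  rw [iInf, Real.sInf_def, neg_neg, iSup]
  congr 1
  ext a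
  simp [neg_eq_iff_eq_neg]

lemma iInf_coneAverage_neg (p s ε : ℝ) (u : E N → ℝ) (x : E N) :
    ⨅ y : S N, coneAverage p s ε (fun z => -u z) x y = -⨆ y : S N, coneAverage p s ε u x y := by
  have := iSup_coneAverage_neg p s ε (fun z => -u z) x
  simp only [neg_neg] at this
  rw [this, neg_neg]

lemma avgOp_neg (p s ε : ℝ) (u : E N → ℝ) (x : E N) :
    avgOp p s ε (fun z => -u z) x = -avgOp p s ε u x := by
  rw [avgOp, avgOp, iSup_coneAverage_neg, iInf_coneAverage_neg]
  ring

/-- The supremum over all directions is the supremum over a dense sequence of directions. -/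
lemma lt_iSup_coneAverage_iff {p s : ℝ} (hp : 2 ≤ p) (hs0 : 0 < s) (hs1 : s < 1) {ε : ℝ}
    (hε : 0 < ε) {u : E N → ℝ} (hu : Measurable u) (hb : ∃ C : ℝ, ∀ x, |u x| ≤ C) (x : E N)
    (a : ℝ) : a < ⨆ y : S N, coneAverage p s ε u x y ↔
      ∃ n, a < coneAverage p s ε u x (TopologicalSpace.denseSeq (S N) n) := by
  rw [lt_ciSup_iff (bddAbove_coneAverage hp hs0 hs1 hε hu hb x)]
  constructor
  · rintro ⟨y, hy⟩
    obtain ⟨C, hC⟩ := hb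
    have ho := (lowerSemicontinuous_coneAverage hp hs0 hs1 hε hu hC x).isOpen_preimage a
    obtain ⟨n, h1⟩ := (TopologicalSpace.denseRange_denseSeq (S N)).exists_mem_open ho ⟨y, hy⟩
    exact ⟨n, h1⟩
  · rintro ⟨n, hn⟩
    exact ⟨_, hn⟩

lemma measurable_iSup_coneAverage {p s : ℝ} (hp : 2 ≤ p) (hs0 : 0 < s) (hs1 : s < 1) {ε : ℝ}
    (hε : 0 < ε) {u : E N → ℝ} (hu : Measurable u) (hb : ∃ C : ℝ, ∀ x, |u x| ≤ C) :
    Measurable fun x => ⨆ y : S N, coneAverage p s ε u x y := by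
  refine measurable_of_Ioi fun a => ?_
  have : (fun x => ⨆ y : S N, coneAverage p s ε u x y) ⁻¹' Set.Ioi a =
      ⋃ n, {x | a < coneAverage p s ε u x (TopologicalSpace.denseSeq (S N) n)} := by
    ext x
    simp [lt_iSup_coneAverage_iff hp hs0 hs1 hε hu hb]
  rw [this]
  exact MeasurableSet.iUnion fun n =>
    measurableSet_lt measurable_const (measurable_coneAverage hp hs0 hs1 hε hu _)

lemma measurable_avgOp {p s : ℝ} (hp : 2 ≤ p) (hs0 : 0 < s) (hs1 : s < 1) {ε : ℝ}
    (hε : 0 < ε) {u : E N → ℝ} (hu : Measurable u) (hb : ∃ C : ℝ, ∀ x, |u x| ≤ C) :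
    Measurable (avgOp p s ε u) := by
  have h1 := measurable_iSup_coneAverage hp hs0 hs1 hε hu hb
  have h2 := measurable_iSup_coneAverage hp hs0 hs1 hε hu.neg (u := fun z => -u z)
    (by simpa using hb)
  simp only [iSup_coneAverage_neg] at h2
  have h : avgOp p s ε u = fun x => ((⨆ y : S N, coneAverage p s ε u x y) -
      -⨅ y : S N, coneAverage p s ε u x y) / 2 := by
    funext x
    rw [sub_neg_eq_add, avgOp]
  rw [h]
  exact (h1.sub h2).div_const 2

/-- A Borel selection of almost maximizing directions. -/
lemma exists_measurable_almost_max {p s : ℝ} (hp : 2 ≤ p) (hs0 : 0 < s) (hs1 : s < 1) {ε : ℝ}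
    (hε : 0 < ε) {u : E N → ℝ} (hu : Measurable u) (hb : ∃ C : ℝ, ∀ x, |u x| ≤ C) {η : ℝ}
    (hη : 0 < η) : ∃ φ : E N → S N, Measurable φ ∧
      ∀ x, (⨆ y : S N, coneAverage p s ε u x y) - η < coneAverage p s ε u x (φ x) := by
  classical
  have h : ∀ x, ∃ n, (⨆ y : S N, coneAverage p s ε u x y) - η <
      coneAverage p s ε u x (TopologicalSpace.denseSeq (S N) n) := fun x =>
    (lt_iSup_coneAverage_iff hp hs0 hs1 hε hu hb x _).1 (sub_lt_self _ hη)
  -- Taking the least admissible index makes the selection Borel.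
  refine ⟨fun x => TopologicalSpace.denseSeq (S N) (Nat.find (h x)), ?_, fun x => Nat.find_spec (h x)⟩
  refine (measurable_from_nat (f := TopologicalSpace.denseSeq (S N))).comp
    (measurable_find h fun n => ?_)
  exact measurableSet_lt ((measurable_iSup_coneAverage hp hs0 hs1 hε hu hb).sub_const η)
    (measurable_coneAverage hp hs0 hs1 hε hu _)

/-- A Borel selection of almost minimizing directions. -/
lemma exists_measurable_almost_min {p s : ℝ} (hp : 2 ≤ p) (hs0 : 0 < s) (hs1 : s < 1) {ε : ℝ}
    (hε : 0 < ε) {u : E N → ℝ} (hu : Measurable u) (hb : ∃ C : ℝ, ∀ x, |u x| ≤ C) {η : ℝ}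
    (hη : 0 < η) : ∃ φ : E N → S N, Measurable φ ∧
      ∀ x, coneAverage p s ε u x (φ x) < (⨅ y : S N, coneAverage p s ε u x y) + η := by
  obtain ⟨φ, hφ, h⟩ := exists_measurable_almost_max hp hs0 hs1 hε hu.neg (u := fun z => -u z)
    (by simpa using hb) hη
  refine ⟨φ, hφ, fun x => ?_⟩
  have := h x
  rw [iSup_coneAverage_neg, coneAverage_neg] at this
  linarith

lemma abs_ciSup_sub_ciSup_le {ι : Type*} [Nonempty ι] {f g : ι → ℝ} {K : ℝ}
    (hf : BddAbove (Set.range f)) (hg : BddAbove (Set.range g)) (h : ∀ i, |f i - g i| ≤ K) :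
    |(⨆ i, f i) - ⨆ i, g i| ≤ K := by
  have h1 : ⨆ i, f i ≤ (⨆ i, g i) + K := ciSup_le fun i => by
    linarith [(abs_le.1 (h i)).2, le_ciSup hg i]
  have h2 : ⨆ i, g i ≤ (⨆ i, f i) + K := ciSup_le fun i => by
    linarith [(abs_le.1 (h i)).1, le_ciSup hf i]
  rw [abs_le]
  constructor <;> linarith

lemma abs_ciInf_sub_ciInf_le {ι : Type*} [Nonempty ι] {f g : ι → ℝ} {K : ℝ}
    (hf : BddBelow (Set.range f)) (hg : BddBelow (Set.range g)) (h : ∀ i, |f i - g i| ≤ K) :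
    |(⨅ i, f i) - ⨅ i, g i| ≤ K := by
  have h1 : (⨅ i, f i) - K ≤ ⨅ i, g i := le_ciInf fun i => by
    linarith [(abs_le.1 (h i)).2, ciInf_le hf i]
  have h2 : (⨅ i, g i) - K ≤ ⨅ i, f i := le_ciInf fun i => by
    linarith [(abs_le.1 (h i)).1, ciInf_le hg i]
  rw [abs_le]
  constructor <;> linarith

lemma abs_avgOp_le {p s : ℝ} (hp : 2 ≤ p) (hs0 : 0 < s) (hs1 : s < 1) {ε : ℝ}
    (hε : 0 < ε) {u : E N → ℝ} (hu : Measurable u) {C : ℝ} (hC : ∀ x, |u x| ≤ C) (x : E N) :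
    |avgOp p s ε u x| ≤ C := by
  have hle := fun y => abs_le.1 (abs_coneAverage_le hp hs0 hs1 hε hu hC x y)
  have y₀ : S N := Classical.arbitrary _
  have ha := bddAbove_coneAverage hp hs0 hs1 hε hu ⟨C, hC⟩ x
  have hb := bddBelow_coneAverage hp hs0 hs1 hε hu ⟨C, hC⟩ x
  have h1 : ⨆ y : S N, coneAverage p s ε u x y ≤ C := ciSup_le fun y => (hle y).2
  have h2 : -C ≤ ⨅ y : S N, coneAverage p s ε u x y := le_ciInf fun y => (hle y).1
  have h3 := le_ciSup ha y₀
  have h4 := ciInf_le hb y₀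
  rw [avgOp, abs_le]
  constructor <;> linarith [(hle y₀).1, (hle y₀).2]

/-- On functions with common values outside a bounded set, the averaging operator is a
contraction in this set. -/
lemma exists_avgOp_contraction {p s : ℝ} (hp : 2 ≤ p) (hs0 : 0 < s) (hs1 : s < 1) {ε : ℝ}
    (hε : 0 < ε) {D : Set (E N)} (hD : Bornology.IsBounded D) :
    ∃ r : ℝ, 0 ≤ r ∧ r < 1 ∧ ∀ u v : E N → ℝ, Measurable u → Measurable v →
      (∃ C : ℝ, ∀ x, |u x| ≤ C) → (∃ C : ℝ, ∀ x, |v x| ≤ C) → (∀ x ∉ D, u x = v x) →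
      ∀ M : ℝ, (∀ x, |u x - v x| ≤ M) →
        ∀ x ∈ D, |avgOp p s ε u x - avgOp p s ε v x| ≤ r * M := by
  have := isProbabilityMeasure_jumpLaw (N := N) hp hs0 hs1
  obtain ⟨d, hd⟩ := Metric.isBounded_iff.1 hD
  -- With `d` bounding the distances in `D`, a jump between two points of `D` satisfies `ε * ‖z‖ ≤
  -- d`. Outside `B` the landing point is off `D`, where `u` and `v` agree.
  set B : Set (E N) := {z | ‖z‖ ≤ d / ε} with hB
  have hBm : MeasurableSet B := (isClosed_le (by fun_prop) (by fun_prop)).measurableSet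
  refine ⟨(jumpLaw N p s).real B, measureReal_nonneg, ?_, ?_⟩
  · rw [measureReal_def, ← ENNReal.toReal_one]
    exact (ENNReal.toReal_lt_toReal (measure_ne_top _ _) ENNReal.one_ne_top).2
      (jumpLaw_norm_le_lt_one hp hs0 hs1 _)
  intro u v hu hv hub hvb huv M hM x hx
  have hM0 : 0 ≤ M := (abs_nonneg _).trans (hM x)
  have key : ∀ y : S N, |coneAverage p s ε u x y - coneAverage p s ε v x y| ≤
      (jumpLaw N p s).real B * M := by
    intro y
    have hi : ∀ w : E N → ℝ, Measurable w → (∃ C : ℝ, ∀ x, |w x| ≤ C) →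
        Integrable (fun z => w (x + ε • rot y z)) (jumpLaw N p s) := by
      rintro w hw ⟨C, hC⟩
      exact Integrable.of_bound
        (hw.comp (by fun_prop : Measurable fun z => x + ε • rot y z)).aestronglyMeasurable C (Filter.Eventually.of_forall fun z => hC _)
    rw [coneAverage_eq s hε hu, coneAverage_eq s hε hv, ← integral_sub (hi u hu hub) (hi v hv hvb),
      ← Real.norm_eq_abs]
    have hBM : ∫ z, B.indicator (fun _ => M) z ∂jumpLaw N p s = (jumpLaw N p s).real B * M := by
      rw [integral_indicator hBm, setIntegral_const, smul_eq_mul]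
    rw [← hBM]
    refine norm_integral_le_of_norm_le ((integrable_const M).indicator hBm)
      (Filter.Eventually.of_forall fun z => ?_)
    by_cases hz : z ∈ B
    · rw [Set.indicator_of_mem hz]
      exact hM _
    · rw [Set.indicator_of_notMem hz, huv, sub_self, norm_zero]
      intro hmem
      apply hz
      have h1 := hd hmem hx
      rw [dist_eq_norm, add_sub_cancel_left, norm_smul, Real.norm_of_nonneg hε.le,
        LinearIsometryEquiv.norm_map] at h1
      rw [hB, Set.mem_ofPred_eq, le_div_iff₀ hε]
      linarith
  have h1 := abs_le.1 (abs_ciSup_sub_ciSup_le (bddAbove_coneAverage hp hs0 hs1 hε hu hub x)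
    (bddAbove_coneAverage hp hs0 hs1 hε hv hvb x) key)
  have h2 := abs_le.1 (abs_ciInf_sub_ciInf_le (bddBelow_coneAverage hp hs0 hs1 hε hu hub x)
    (bddBelow_coneAverage hp hs0 hs1 hε hv hvb x) key)
  rw [avgOp, avgOp, abs_le]
  constructor <;> linarith [h1.1, h1.2, h2.1, h2.2]

/-- Iterating the contraction improves a bound on `|u - v|` by the factor `r` each time. -/
lemma IsDPPSolution.unique {p s : ℝ} (hp : 2 ≤ p) (hs0 : 0 < s) (hs1 : s < 1) {ε : ℝ}
    (hε : 0 < ε) {D : Set (E N)} (hD : Bornology.IsBounded D) {F u v : E N → ℝ}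
    (hu : IsDPPSolution p s ε D F u) (hv : IsDPPSolution p s ε D F v) : u = v := by
  obtain ⟨r, hr0, hr1, hr⟩ := exists_avgOp_contraction hp hs0 hs1 hε hD
  obtain ⟨A, hA⟩ := hu.bounded
  obtain ⟨B, hB⟩ := hv.bounded
  have hout : ∀ x ∉ D, u x = v x := fun x hx => by rw [hu.eq_data x hx, hv.eq_data x hx]
  have key : ∀ n : ℕ, ∀ x, |u x - v x| ≤ r ^ n * (A + B) := by
    intro n
    induction n with
    | zero =>
      intro x
      rw [pow_zero, one_mul]
      exact (abs_sub _ _).trans (add_le_add (hA x) (hB x))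
    | succ n ih =>
      intro x
      by_cases hx : x ∈ D
      · rw [hu.eq_avgOp x hx, hv.eq_avgOp x hx, pow_succ', mul_assoc]
        exact hr u v hu.measurable hv.measurable hu.bounded hv.bounded hout _ ih x hx
      · rw [hout x hx, sub_self, abs_zero]
        exact mul_nonneg (pow_nonneg hr0 _)
          (add_nonneg ((abs_nonneg _).trans (hA x)) ((abs_nonneg _).trans (hB x)))
  funext x
  have hlim := (tendsto_pow_atTop_nhds_zero_of_lt_one hr0 hr1).mul_const (A + B)
  rw [zero_mul] at hlim
  have := ge_of_tendsto' hlim fun n => key n x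
  exact sub_eq_zero.1 (abs_nonpos_iff.1 this)

/-- Picard iteration started at `F`; pointwise limits keep the iterates' measurability and their
bound `C`. -/
lemma exists_isDPPSolution {p s : ℝ} (hp : 2 ≤ p) (hs0 : 0 < s) (hs1 : s < 1) {ε : ℝ}
    (hε : 0 < ε) {D : Set (E N)} (hDm : MeasurableSet D) (hD : Bornology.IsBounded D)
    {F : E N → ℝ} (hF : Measurable F) (hFb : ∃ C : ℝ, ∀ x, |F x| ≤ C) :
    ∃ u, IsDPPSolution p s ε D F u := by
  classical
  obtain ⟨r, hr0, hr1, hr⟩ := exists_avgOp_contraction hp hs0 hs1 hε hD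
  obtain ⟨C, hC⟩ := hFb
  let T : (E N → ℝ) → E N → ℝ := fun u x => if x ∈ D then avgOp p s ε u x else F x
  have hTin : ∀ u, ∀ x ∈ D, T u x = avgOp p s ε u x := fun u x hx => if_pos hx
  have hTout : ∀ u, ∀ x ∉ D, T u x = F x := fun u x hx => if_neg hx
  let U : ℕ → E N → ℝ := fun n => T^[n] F
  have hUs : ∀ n, U (n + 1) = T (U n) := fun n => Function.iterate_succ_apply' T n F
  have hU : ∀ n, Measurable (U n) ∧ (∀ x, |U n x| ≤ C) ∧ ∀ x ∉ D, U n x = F x := by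
    intro n
    induction n with
    | zero => exact ⟨hF, hC, fun x _ => rfl⟩
    | succ n ih =>
      rw [hUs]
      refine ⟨Measurable.ite hDm (measurable_avgOp hp hs0 hs1 hε ih.1 ⟨C, ih.2.1⟩) hF, fun x => ?_,
        hTout _⟩
      by_cases hx : x ∈ D
      · rw [hTin _ x hx]; exact abs_avgOp_le hp hs0 hs1 hε ih.1 ih.2.1 x
      · rw [hTout _ x hx]; exact hC x
  have hcontr : ∀ n m M, (∀ x, |U n x - U m x| ≤ M) → ∀ x, |U (n + 1) x - U (m + 1) x| ≤ r * M := by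
    intro n m M hM x
    rw [hUs, hUs]
    by_cases hx : x ∈ D
    · rw [hTin _ x hx, hTin _ x hx]
      exact hr _ _ (hU n).1 (hU m).1 ⟨C, (hU n).2.1⟩ ⟨C, (hU m).2.1⟩
        (fun z hz => by rw [(hU n).2.2 z hz, (hU m).2.2 z hz]) M hM x hx
    · rw [hTout _ x hx, hTout _ x hx, sub_self, abs_zero]
      exact mul_nonneg hr0 ((abs_nonneg _).trans (hM x))
  have hstep : ∀ n x, dist (U n x) (U (n + 1) x) ≤ (2 * C) * r ^ n := by
    intro n
    induction n with
    | zero =>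
      intro x
      rw [pow_zero, mul_one, Real.dist_eq]
      linarith [abs_sub (U 0 x) (U (0 + 1) x), (hU 0).2.1 x, (hU (0 + 1)).2.1 x]
    | succ n ih =>
      intro x
      rw [Real.dist_eq, pow_succ', mul_left_comm]
      exact hcontr n (n + 1) _ ih x
  have hlim : ∀ x, ∃ l, Filter.Tendsto (fun n => U n x) Filter.atTop (nhds l) := fun x =>
    cauchySeq_tendsto_of_complete (cauchySeq_of_le_geometric r (2 * C) hr1 fun n => hstep n x)
  choose u hu using hlim
  have hum : Measurable u := measurable_of_tendsto_metrizable (fun n => (hU n).1)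
    (tendsto_pi_nhds.2 hu)
  have hub : ∀ x, |u x| ≤ C := fun x => le_of_tendsto' (hu x).abs fun n => (hU n).2.1 x
  have hout : ∀ x ∉ D, u x = F x := fun x hx =>
    tendsto_nhds_unique (hu x) (tendsto_const_nhds.congr fun n => ((hU n).2.2 x hx).symm)
  refine ⟨u, hum, ⟨C, hub⟩, fun x hx => ?_, hout⟩
  -- The convergence is uniform in `z`, so the contraction estimate lets the limit pass through the
  -- operator.
  have herr : ∀ n z, |U n z - u z| ≤ (2 * C) * r ^ n / (1 - r) := fun n z =>
    dist_le_of_le_geometric_of_tendsto r (2 * C) hr1 (fun n => hstep n z) (hu z) n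
  have hT : Filter.Tendsto (fun n => U (n + 1) x) Filter.atTop (nhds (avgOp p s ε u x)) := by
    rw [tendsto_iff_dist_tendsto_zero]
    have h0 : Filter.Tendsto (fun n : ℕ => r * ((2 * C) * r ^ n / (1 - r))) Filter.atTop
        (nhds 0) := by
      have := (((tendsto_pow_atTop_nhds_zero_of_lt_one hr0 hr1).const_mul (2 * C)).div_const
        (1 - r)).const_mul r
      simpa using this
    refine squeeze_zero (fun _ => dist_nonneg) (fun n => ?_) h0
    rw [Real.dist_eq, hUs, hTin _ x hx]
    exact hr _ _ (hU n).1 hum ⟨C, (hU n).2.1⟩ ⟨C, hub⟩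
      (fun z hz => by rw [(hU n).2.2 z hz, hout z hz]) _ (herr n) x hx
  exact tendsto_nhds_unique ((Filter.tendsto_add_atTop_iff_nat 1).2 (hu x)) hT

end DPP
-- Resampling one turn of a product space.
/-- Resampling one coordinate preserves an infinite product of copies of a probability measure. -/
lemma measurePreserving_update {X : Type*} [MeasurableSpace X] (ν : Measure X)
    [IsProbabilityMeasure ν] (n : ℕ) :
    MeasurePreserving (fun q : (ℕ → X) × X => Function.update q.1 n q.2)
      ((Measure.infinitePi fun _ : ℕ => ν).prod ν) (Measure.infinitePi fun _ : ℕ => ν) := by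
  have hm : Measurable fun q : (ℕ → X) × X => Function.update q.1 n q.2 := by
    refine measurable_pi_iff.2 fun i => ?_
    by_cases h : i = n
    · subst h; simpa using measurable_snd
    · simp only [Function.update_of_ne h]; fun_prop
  refine ⟨hm, Measure.eq_infinitePi _ fun s t ht => ?_⟩
  rw [Measure.map_apply hm (MeasurableSet.pi s.countable_toSet fun i _ => ht i)]
  -- Coordinate `n` of the old sequence is discarded; the new one is constrained only if `n ∈ s`.
  have hpre : (fun q : (ℕ → X) × X => Function.update q.1 n q.2) ⁻¹' Set.pi s t =
      Set.pi (s.erase n : Finset ℕ) t ×ˢ {a | n ∈ s → a ∈ t n} := by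
    ext q
    simp only [Set.mem_preimage, Set.mem_pi, Set.mem_prod, Set.mem_ofPred_eq, Finset.coe_erase,
      Set.mem_sdiff, Finset.mem_coe, Set.mem_singleton_iff]
    constructor
    · intro h
      refine ⟨fun i hi => ?_, fun hn => ?_⟩
      · simpa [Function.update_of_ne hi.2] using h i hi.1
      · simpa using h n hn
    · rintro ⟨h1, h2⟩ i hi
      by_cases hin : i = n
      · subst hin; simpa using h2 hi
      · simpa [Function.update_of_ne hin] using h1 i ⟨hi, hin⟩
  rw [hpre, Measure.prod_prod, Measure.infinitePi_pi _ fun i _ => ht i]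
  by_cases hn : n ∈ s
  · simp only [hn, true_implies, Set.ofPred_mem_eq]
    exact Finset.prod_erase_mul s _ hn
  · simp [hn]

/-! ### Measurability of the game, its duration, and the payoff inequality. -/

section Game

variable {N : ℕ} [N.AtLeastTwo] {p : ℝ}

lemma measurable_history_last {n : ℕ} : Measurable (History.last : History N p n → E N) := by
  cases n with
  | zero => exact measurable_fst
  | succ n =>
    exact measurable_fst.comp ((measurable_pi_apply (Fin.last n)).comp measurable_snd)

lemma measurable_nextPosition (ε : ℝ) (σI σII : Strategy N p) (n : ℕ) :
    Measurable fun q : History N p n × Turn N p => nextPosition ε σI σII q.1 q.2 := by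
  have h1 : Measurable fun q : History N p n × Turn N p =>
      if q.2.2 = 0 then σI.toFun n q.1 else σII.toFun n q.1 :=
    Measurable.ite (measurable_snd.comp measurable_snd (measurableSet_singleton 0))
      ((σI.measurable n).comp measurable_fst) ((σII.measurable n).comp measurable_fst)
  have h2 : Measurable fun q : History N p n × Turn N p => (q.2.1 : E N) := by fun_prop
  exact (measurable_history_last.comp measurable_fst).add
    ((measurable_rot.comp (h1.prodMk h2)).const_smul ε)

lemma measurable_history (ε : ℝ) (x : E N) (σI σII : Strategy N p) (n : ℕ) :
    Measurable (history ε x σI σII n) := by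
  induction n with
  | zero => exact measurable_const
  | succ n ih =>
    refine measurable_const.prodMk (measurable_pi_iff.2 fun i => ?_)
    refine Fin.lastCases ?_ (fun j => ?_) i
    · simp only [Fin.snoc_last]
      exact ((measurable_nextPosition ε σI σII n).comp (ih.prodMk (measurable_pi_apply n))).prodMk
        (measurable_pi_apply n)
    · simp only [Fin.snoc_castSucc]
      exact (measurable_pi_apply j).comp (measurable_snd.comp ih)

lemma measurable_position (ε : ℝ) (x : E N) (σI σII : Strategy N p) (n : ℕ) :
    Measurable (position ε x σI σII n) :=
  measurable_history_last.comp (measurable_history ε x σI σII n)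

lemma position_succ (ε : ℝ) (x : E N) (σI σII : Strategy N p) (n : ℕ) (ω : ℕ → Turn N p) :
    position ε x σI σII (n + 1) ω = nextPosition ε σI σII (history ε x σI σII n ω) (ω n) := by
  simp [position, history, History.last]

/-- The history after `m` turns does not depend on the later turns. -/
lemma history_update (ε : ℝ) (x : E N) (σI σII : Strategy N p) (n : ℕ) (ω : ℕ → Turn N p)
    (t : Turn N p) {m : ℕ} (hm : m ≤ n) :
    history ε x σI σII m (Function.update ω n t) = history ε x σI σII m ω := by
  induction m with
  | zero => rfl
  | succ m ih =>
    simp only [history]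
    rw [ih (by omega), Function.update_of_ne (by omega)]

lemma position_update (ε : ℝ) (x : E N) (σI σII : Strategy N p) (n : ℕ) (ω : ℕ → Turn N p)
    (t : Turn N p) {m : ℕ} (hm : m ≤ n) :
    position ε x σI σII m (Function.update ω n t) = position ε x σI σII m ω := by
  rw [position, history_update ε x σI σII n ω t hm, position]

/-- The event that the game has not stopped after `n` turns. -/
def alive (ε : ℝ) (D : Set (E N)) (x : E N) (σI σII : Strategy N p) (n : ℕ) :
    Set (ℕ → Turn N p) :=
  {ω | ∀ k, 1 ≤ k → k ≤ n → position ε x σI σII k ω ∈ D}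

lemma measurableSet_alive (ε : ℝ) {D : Set (E N)} (hD : MeasurableSet D) (x : E N)
    (σI σII : Strategy N p) (n : ℕ) : MeasurableSet (alive ε D x σI σII n) := by
  have : alive ε D x σI σII n =
      ⋂ k, ⋂ (_ : 1 ≤ k), ⋂ (_ : k ≤ n), position ε x σI σII k ⁻¹' D := by
    ext ω
    simp [alive]
  rw [this]
  exact MeasurableSet.iInter fun k => MeasurableSet.iInter fun _ => MeasurableSet.iInter fun _ =>
    measurable_position ε x σI σII k hD

/-- The event involves only the entries `ω 0, …, ω (n - 1)`, that is, the first `n` turns. -/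
lemma update_mem_alive_iff (ε : ℝ) (D : Set (E N)) (x : E N) (σI σII : Strategy N p) (n : ℕ)
    (ω : ℕ → Turn N p) (t : Turn N p) :
    Function.update ω n t ∈ alive ε D x σI σII n ↔ ω ∈ alive ε D x σI σII n := by
  refine forall_congr' fun k => forall_congr' fun _ => forall_congr' fun hk => ?_
  rw [position_update ε x σI σII n ω t hk]

lemma mem_alive_succ_iff (ε : ℝ) (D : Set (E N)) (x : E N) (σI σII : Strategy N p) (n : ℕ)
    (ω : ℕ → Turn N p) : ω ∈ alive ε D x σI σII (n + 1) ↔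
      ω ∈ alive ε D x σI σII n ∧ position ε x σI σII (n + 1) ω ∈ D := by
  constructor
  · exact fun h => ⟨fun k h1 h2 => h k h1 (by omega), h _ (by omega) le_rfl⟩
  · rintro ⟨h1, h2⟩ k hk1 hk2
    rcases hk2.lt_or_eq with h | rfl
    · exact h1 k hk1 (by omega)
    · exact h2

/-- The final position of the game is a random variable. -/
lemma measurable_stoppedValue_position (ε : ℝ) {D : Set (E N)} (hD : MeasurableSet D) (x : E N)
    (σI σII : Strategy N p) :
    Measurable (stoppedValue (position ε x σI σII) (exitTime ε D x σI σII)) := by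
  -- Only measurability of the final position is wanted, so the constant filtration, to which
  -- everything is adapted, is enough.
  let ℱ : Filtration ℕ (MeasurableSpace.pi : MeasurableSpace (ℕ → Turn N p)) :=
    Filtration.const ℕ _ le_rfl
  have hτ : IsStoppingTime ℱ (exitTime ε D x σI σII) :=
    Adapted.isStoppingTime_hittingAfter (f := ℱ)
      (fun n => measurable_position ε x σI σII n) hD.compl
  have hu : StronglyAdapted ℱ (position ε x σI σII) := fun n =>
    (measurable_position ε x σI σII n).stronglyMeasurable
  exact (measurable_stoppedValue hu.isStronglyProgressive_of_discrete hτ).mono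
    hτ.measurableSpace_le le_rfl

lemma stoppedValue_of_exit (ε : ℝ) (D : Set (E N)) (x : E N) (σI σII : Strategy N p) {n : ℕ}
    {ω : ℕ → Turn N p} (h : ω ∈ alive ε D x σI σII n)
    (h' : position ε x σI σII (n + 1) ω ∉ D) :
    stoppedValue (position ε x σI σII) (exitTime ε D x σI σII) ω =
      position ε x σI σII (n + 1) ω := by
  have hle : exitTime ε D x σI σII ω ≤ WithTop.some (n + 1) :=
    hittingAfter_le_of_mem (Nat.le_add_left 1 n) h'
  have hge : ¬ exitTime ε D x σI σII ω < WithTop.some (n + 1) := by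
    rw [exitTime, hittingAfter_lt_iff]
    rintro ⟨j, hj, hjD⟩
    exact hjD (h j hj.1 (Nat.lt_succ_iff.1 hj.2))
  have : exitTime ε D x σI σII ω = WithTop.some (n + 1) := le_antisymm hle (not_lt.1 hge)
  rw [stoppedValue, this]
  rfl

lemma turnMeasure_norm_le (s d : ℝ) :
    turnMeasure N p s {t | ‖(t.1 : E N)‖ ≤ d} ≤ jumpLaw N p s {z | ‖z‖ ≤ d} := by
  have h3 : IsProbabilityMeasure (ProbabilityTheory.uniformOn (Set.univ : Set (Fin 2))) :=
    ProbabilityTheory.isProbabilityMeasure_uniformOn Set.finite_univ Set.univ_nonempty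
  have : {t : Turn N p | ‖(t.1 : E N)‖ ≤ d} = (Subtype.val ⁻¹' {z : E N | ‖z‖ ≤ d}) ×ˢ Set.univ := by
    ext t
    simp
  rw [this, turnMeasure, Measure.prod_prod, measure_univ, mul_one,
    (MeasurableEmbedding.subtype_coe (measurableSet_cone_e₁ p)).comap_apply]
  exact measure_mono (Set.image_preimage_subset _ _)

/-- The link between the game and the operator: integrating the fair coin out gives each player's
cone average the weight `1 / 2`. -/
lemma integral_turnMeasure {s : ℝ} (hp : 2 ≤ p) (hs0 : 0 < s) (hs1 : s < 1) {ε : ℝ} (hε : 0 < ε)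
    {u : E N → ℝ} (hu : Measurable u) (hb : ∃ C : ℝ, ∀ x, |u x| ≤ C) (σI σII : Strategy N p)
    {n : ℕ} (h : History N p n) :
    ∫ t, u (nextPosition ε σI σII h t) ∂turnMeasure N p s =
      (coneAverage p s ε u h.last (σI.toFun n h) + coneAverage p s ε u h.last (σII.toFun n h)) / 2 := by
  have h3 : IsProbabilityMeasure (ProbabilityTheory.uniformOn (Set.univ : Set (Fin 2))) :=
    ProbabilityTheory.isProbabilityMeasure_uniformOn Set.finite_univ Set.univ_nonempty
  have hjp := isProbabilityMeasure_jumpLaw (N := N) hp hs0 hs1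
  have hC := (MeasurableEmbedding.subtype_coe (measurableSet_cone_e₁ (N := N) p))
  have hcond : (jumpLaw N p s).restrict (cone p 1 e₁) = jumpLaw N p s := by
    rw [jumpLaw, ProbabilityTheory.cond, Measure.restrict_smul, Measure.restrict_restrict
      (measurableSet_cone_e₁ p), Set.inter_self]
  have : IsFiniteMeasure
        ((jumpLaw N p s).comap (Subtype.val : ↥(cone p 1 (e₁ : E N)) → E N)) :=
      ⟨by rw [hC.comap_apply]; exact measure_lt_top _ _⟩
  have hsub : ∀ f : E N → ℝ,
      ∫ z : ↥(cone p 1 (e₁ : E N)), f z ∂(jumpLaw N p s).comap Subtype.val =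
        ∫ z, f z ∂jumpLaw N p s := by
    intro f
    rw [integral_subtype_comap (measurableSet_cone_e₁ p), hcond]
  have hm : Measurable fun t => u (nextPosition ε σI σII h t) :=
    hu.comp ((measurable_nextPosition ε σI σII n).comp (measurable_const.prodMk measurable_id))
  obtain ⟨C, hC⟩ := hb
  have hi : Integrable (fun t => u (nextPosition ε σI σII h t))
      (((jumpLaw N p s).comap Subtype.val).prod (ProbabilityTheory.uniformOn Set.univ)) :=
    Integrable.of_bound hm.aestronglyMeasurable C (Filter.Eventually.of_forall fun _ => hC _)
  rw [coneAverage_eq s hε hu, coneAverage_eq s hε hu]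
  change ∫ t, u (nextPosition ε σI σII h t)
    ∂((jumpLaw N p s).comap Subtype.val).prod (ProbabilityTheory.uniformOn Set.univ) = _
  rw [integral_prod_symm _ hi, integral_fintype Integrable.of_finite, Fin.sum_univ_two]
  have hhalf : ∀ i : Fin 2, (ProbabilityTheory.uniformOn (Set.univ : Set (Fin 2))).real {i} = 1 / 2 := by
    intro i
    rw [measureReal_def, ProbabilityTheory.uniformOn_univ]
    simp
  rw [hhalf, hhalf]
  simp only [nextPosition, if_true, one_ne_zero, if_false]
  rw [hsub fun z => u (h.last + ε • rot (σI.toFun n h) z),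
    hsub fun z => u (h.last + ε • rot (σII.toFun n h) z), smul_eq_mul, smul_eq_mul]
  ring

/-- The probability that the game goes on decays geometrically, uniformly in the strategies. -/
lemma exists_alive_le {s : ℝ} (hp : 2 ≤ p) (hs0 : 0 < s) (hs1 : s < 1) {ε : ℝ} (hε : 0 < ε)
    {D : Set (E N)} (hD : Bornology.IsBounded D) :
    ∃ r : ℝ, 0 ≤ r ∧ r < 1 ∧ ∀ (x : E N) (σI σII : Strategy N p) (n : ℕ),
      (gameMeasure N p s).real (alive ε D x σI σII (n + 1)) ≤ r ^ n := by
  have := isProbabilityMeasure_turnMeasure (N := N) hp hs0 hs1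
  obtain ⟨d, hd⟩ := Metric.isBounded_iff.1 hD
  set B : Set (Turn N p) := {t | ‖(t.1 : E N)‖ ≤ d / ε} with hB
  have hBm : MeasurableSet B := measurableSet_le (by fun_prop) measurable_const
  refine ⟨(turnMeasure N p s).real B, measureReal_nonneg, ?_, fun x σI σII n => ?_⟩
  · exact ((ENNReal.toReal_lt_toReal (measure_ne_top _ _) ENNReal.one_ne_top).2
      ((turnMeasure_norm_le s _).trans_lt (jumpLaw_norm_le_lt_one hp hs0 hs1 _))).trans_eq
      ENNReal.toReal_one
  -- Two consecutive positions in `D` force the turn `ω k` between them into `B`. The turn `ω 0`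
  -- gives no constraint, since the start may lie off `D`; hence `n + 1` turns yield the power `n`.
  have hsub : alive ε D x σI σII (n + 1) ⊆ Set.pi (Finset.Icc 1 n : Finset ℕ) fun _ => B := by
    intro ω hω k hk
    rw [Finset.mem_coe, Finset.mem_Icc] at hk
    have h1 := hω k hk.1 (by omega)
    have h2 := hω (k + 1) (by omega) (by omega)
    have h3 := hd h2 h1
    rw [position_succ, nextPosition, ← position, dist_eq_norm, add_sub_cancel_left, norm_smul,
      Real.norm_of_nonneg hε.le, LinearIsometryEquiv.norm_map] at h3
    rw [hB, Set.mem_ofPred_eq, le_div_iff₀ hε]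
    linarith
  unfold gameMeasure
  refine (measureReal_mono hsub).trans ?_
  rw [measureReal_def, Measure.infinitePi_pi _ fun _ _ => hBm, Finset.prod_const, Nat.card_Icc,
    ENNReal.toReal_pow, add_tsub_cancel_right, measureReal_def]

/-- If, at every history, the mean of the two cone averages of `u` in the directions of the players
exceeds `w` by at most `η`, where `w = u` in `D`, then the expected payoff at `x` exceeds `w x` by
at most `η` for each of the first `n` turns, up to the event that the game lasts longer. -/
lemma expectedPayoff_le {s : ℝ} (hp : 2 ≤ p) (hs0 : 0 < s) (hs1 : s < 1) {ε : ℝ} (hε : 0 < ε)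
    {D : Set (E N)} (hD : MeasurableSet D) {F u w : E N → ℝ} {C : ℝ} (hF : Measurable F)
    (hu : Measurable u) (hw : Measurable w) (hFC : ∀ x, |F x| ≤ C) (huC : ∀ x, |u x| ≤ C)
    (hwC : ∀ x, |w x| ≤ C) (huF : ∀ x ∉ D, u x = F x) (huw : ∀ x ∈ D, u x = w x)
    {η : ℝ} (hη : 0 ≤ η) (σI σII : Strategy N p)
    (hσ : ∀ (n : ℕ) (h : History N p n), (coneAverage p s ε u h.last (σI.toFun n h) +
      coneAverage p s ε u h.last (σII.toFun n h)) / 2 ≤ w h.last + η) (x : E N) (n : ℕ) :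
    expectedPayoff s ε D F x σI σII ≤
      w x + n * η + 2 * C * (gameMeasure N p s).real (alive ε D x σI σII n) := by
  classical
  have := isProbabilityMeasure_turnMeasure (N := N) hp hs0 hs1
  have hP : IsProbabilityMeasure (gameMeasure N p s) := by unfold gameMeasure; infer_instance
  set P := gameMeasure N p s with hPdef
  let A := alive ε D x σI σII
  have hA : ∀ n, MeasurableSet (A n) := measurableSet_alive ε hD x σI σII
  let X := position ε x σI σII
  have hX : ∀ n, Measurable (X n) := measurable_position ε x σI σII
  let G : (ℕ → Turn N p) → ℝ := fun ω => F (stoppedValue X (exitTime ε D x σI σII) ω)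
  have hG : Measurable G := hF.comp (measurable_stoppedValue_position ε hD x σI σII)
  -- The process equals `w` at the current position while the game runs, and the payoff once it has
  -- stopped.
  let Z : ℕ → (ℕ → Turn N p) → ℝ := fun n ω => if ω ∈ A n then w (X n ω) else G ω
  have hZm : ∀ n, Measurable (Z n) := fun n => Measurable.ite (hA n) (hw.comp (hX n)) hG
  have hZC : ∀ n ω, |Z n ω| ≤ C := by
    intro n ω
    simp only [Z]
    split_ifs
    · exact hwC _
    · exact hFC _
  have hint : ∀ (f : (ℕ → Turn N p) → ℝ) (K : ℝ), Measurable f → (∀ ω, |f ω| ≤ K) →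
      Integrable f P := fun f K hf hK =>
    Integrable.of_bound hf.aestronglyMeasurable K (Filter.Eventually.of_forall hK)
  have hZi : ∀ n, Integrable (Z n) P := fun n => hint _ C (hZm n) (hZC n)
  have hstep : ∀ n, ∫ ω, Z (n + 1) ω ∂P ≤ ∫ ω, Z n ω ∂P + η := by
    intro n
    -- While the game runs, the next value of `Z` is `u` at the new position in both cases: `u = w`
    -- in `D`, and `u = F` at an exit.
    let d : (ℕ → Turn N p) → ℝ := (A n).indicator fun ω => u (X (n + 1) ω) - w (X n ω)
    have hdm : Measurable d := ((hu.comp (hX _)).sub (hw.comp (hX _))).indicator (hA n)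
    have hdC : ∀ ω, |d ω| ≤ 2 * C := by
      intro ω
      have h1 := abs_sub (u (X (n + 1) ω)) (w (X n ω))
      have h2 : |d ω| ≤ |u (X (n + 1) ω) - w (X n ω)| :=
        norm_indicator_le_norm_self (s := A n) (fun ω => u (X (n + 1) ω) - w (X n ω)) ω
      linarith [huC (X (n + 1) ω), hwC (X n ω)]
    have hZd : ∀ ω, Z (n + 1) ω = Z n ω + d ω := by
      intro ω
      by_cases h : ω ∈ A n
      · simp only [d, Z, Set.indicator_of_mem h, if_pos h]
        by_cases h' : X (n + 1) ω ∈ D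
        · rw [if_pos ((mem_alive_succ_iff ε D x σI σII n ω).2 ⟨h, h'⟩), huw _ h']
          ring
        · rw [if_neg fun hc => h' ((mem_alive_succ_iff ε D x σI σII n ω).1 hc).2, huF _ h']
          simp only [G]
          rw [stoppedValue_of_exit ε D x σI σII h h']
          ring
      · simp only [d, Z, Set.indicator_of_notMem h, if_neg h, add_zero]
        rw [if_neg fun hc => h ((mem_alive_succ_iff ε D x σI σII n ω).1 hc).1]
    -- Resampling `ω n`, on which the first `n` turns do not depend, plays the role of conditioning
    -- on these turns.
    have hpres := measurePreserving_update (turnMeasure N p s) n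
    have hprod : Integrable (fun q : (ℕ → Turn N p) × Turn N p => d (Function.update q.1 n q.2))
        (P.prod (turnMeasure N p s)) :=
      Integrable.of_bound (hdm.comp hpres.measurable).aestronglyMeasurable (2 * C)
        (Filter.Eventually.of_forall fun q => hdC _)
    have hdP : ∫ ω, d ω ∂P ≤ η := by
      have h1 : ∫ ω, d ω ∂P = ∫ ω, ∫ t, d (Function.update ω n t) ∂turnMeasure N p s ∂P := by
        have h2 := integral_map (μ := P.prod (turnMeasure N p s)) hpres.measurable.aemeasurable
          (f := d) hdm.aestronglyMeasurable
        have h3 : (P.prod (turnMeasure N p s)).map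
          (fun q : (ℕ → Turn N p) × Turn N p => Function.update q.1 n q.2) = P := hpres.map_eq
        rw [h3] at h2
        rw [h2, integral_prod _ hprod]
      rw [h1]
      have hle : ∀ ω, ∫ t, d (Function.update ω n t) ∂turnMeasure N p s ≤ η := by
        intro ω
        by_cases h : ω ∈ A n
        · have hd : ∀ t, d (Function.update ω n t) =
              u (nextPosition ε σI σII (history ε x σI σII n ω) t) - w (X n ω) := by
            intro t
            simp only [d, X]
            rw [Set.indicator_of_mem ((update_mem_alive_iff ε D x σI σII n ω t).2 h),
              position_succ, position_update ε x σI σII n ω t le_rfl,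
              history_update ε x σI σII n ω t le_rfl, Function.update_self]
          have hm : Measurable fun t => u (nextPosition ε σI σII (history ε x σI σII n ω) t) :=
            hu.comp ((measurable_nextPosition ε σI σII n).comp
              (measurable_const.prodMk measurable_id))
          simp only [hd]
          rw [integral_sub (Integrable.of_bound hm.aestronglyMeasurable C
            (Filter.Eventually.of_forall fun _ => huC _)) (integrable_const _),
            integral_turnMeasure hp hs0 hs1 hε hu ⟨C, huC⟩, integral_const, probReal_univ,
            one_smul]
          linarith [hσ n (history ε x σI σII n ω),
            show w (X n ω) = w (history ε x σI σII n ω).last from rfl]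
        · have hd : ∀ t, d (Function.update ω n t) = 0 := fun t =>
            Set.indicator_of_notMem (fun hc => h ((update_mem_alive_iff ε D x σI σII n ω t).1 hc)) _
          simp only [hd, integral_zero]
          exact hη
      simpa using integral_mono hprod.integral_prod_left (integrable_const η) hle
    calc ∫ ω, Z (n + 1) ω ∂P = ∫ ω, Z n ω ∂P + ∫ ω, d ω ∂P := by
          rw [← integral_add (hZi n) (hint d _ hdm hdC)]
          exact integral_congr_ae (Filter.Eventually.of_forall hZd)
      _ ≤ _ := by linarith
  have hZn : ∀ n : ℕ, ∫ ω, Z n ω ∂P ≤ w x + n * η := by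
    intro n
    induction n with
    | zero =>
      -- Being alive after no turn is a void condition, so this starting value is correct for `x`
      -- off `D` as well.
      have : ∀ ω, Z 0 ω = w x := fun ω => if_pos fun k h1 h2 => by omega
      simp [this]
    | succ n ih =>
      push_cast
      linarith [hstep n]
  -- Off `A n` the game is over and `G = Z n`. On `A n` both are bounded by `C`, whatever
  -- `stoppedValue` returns for a game that never stops.
  have hGZ : ∀ ω, G ω ≤ Z n ω + (A n).indicator (fun _ => 2 * C) ω := by
    intro ω
    by_cases h : ω ∈ A n
    · rw [Set.indicator_of_mem h]
      linarith [(abs_le.1 (hZC n ω)).1, (abs_le.1 (hFC (stoppedValue X (exitTime ε D x σI σII) ω))).2]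
    · simp only [Set.indicator_of_notMem h, Z, if_neg h, add_zero, le_refl]
  have hIi : Integrable ((A n).indicator fun _ => 2 * C) P := (integrable_const _).indicator (hA n)
  have h1 : ∫ ω, G ω ∂P ≤ ∫ ω, (Z n ω + (A n).indicator (fun _ => 2 * C) ω) ∂P :=
    integral_mono (hint G C hG fun ω => hFC _) ((hZi n).add hIi) hGZ
  rw [integral_add (hZi n) hIi, integral_indicator (hA n), setIntegral_const, smul_eq_mul] at h1
  have h2 : expectedPayoff s ε D F x σI σII = ∫ ω, G ω ∂P := rfl
  rw [h2]
  linarith [hZn n, mul_comm (P.real (A n)) (2 * C)]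

end Game
-- Almost optimal strategies and the value of the game.
section Value

variable {N : ℕ} [N.AtLeastTwo] {p : ℝ}

/-- The strategy that chooses a direction depending only on the current position. -/
def Strategy.ofPosition (φ : E N → S N) (hφ : Measurable φ) : Strategy N p where
  toFun _ h := φ h.last
  measurable _ := hφ.comp measurable_history_last

instance nonempty_strategy : Nonempty (Strategy N p) :=
  ⟨Strategy.ofPosition (fun _ => Classical.arbitrary _) measurable_const⟩

lemma abs_expectedPayoff_le {s : ℝ} (hp : 2 ≤ p) (hs0 : 0 < s) (hs1 : s < 1) (ε : ℝ)
    (D : Set (E N)) {F : E N → ℝ} {C : ℝ} (hFC : ∀ x, |F x| ≤ C) (x : E N)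
    (σI σII : Strategy N p) : |expectedPayoff s ε D F x σI σII| ≤ C := by
  have := isProbabilityMeasure_turnMeasure (N := N) hp hs0 hs1
  have hP : IsProbabilityMeasure (gameMeasure N p s) := by unfold gameMeasure; infer_instance
  rw [expectedPayoff, ← Real.norm_eq_abs]
  simpa using norm_integral_le_of_norm_le_const (μ := gameMeasure N p s)
    (f := fun ω => F (stoppedValue (position ε x σI σII) (exitTime ε D x σI σII) ω))
    (Filter.Eventually.of_forall fun ω => hFC _)

lemma expectedPayoff_neg (s ε : ℝ) (D : Set (E N)) (F : E N → ℝ) (x : E N)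
    (σI σII : Strategy N p) :
    expectedPayoff s ε D (fun z => -F z) x σI σII = -expectedPayoff s ε D F x σI σII := by
  simp only [expectedPayoff, integral_neg]

/-- For strategies that are almost optimal at each turn in the sense of `expectedPayoff_le`, with an
error that is small enough uniformly in the strategies, the expected payoff is almost bounded by
the average of the solution. -/
lemma IsDPPSolution.exists_expectedPayoff_le {s : ℝ} (hp : 2 ≤ p) (hs0 : 0 < s) (hs1 : s < 1)
    {ε : ℝ} (hε : 0 < ε) {D : Set (E N)} (hDm : MeasurableSet D) (hD : Bornology.IsBounded D)
    {F u : E N → ℝ} (hF : Measurable F) (hFb : ∃ C : ℝ, ∀ x, |F x| ≤ C)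
    (hu : IsDPPSolution p s ε D F u) {δ : ℝ} (hδ : 0 < δ) :
    ∃ η : ℝ, 0 < η ∧ ∀ σI σII : Strategy N p,
      (∀ (n : ℕ) (h : History N p n), (coneAverage p s ε u h.last (σI.toFun n h) +
        coneAverage p s ε u h.last (σII.toFun n h)) / 2 ≤ avgOp p s ε u h.last + η) →
      ∀ x, expectedPayoff s ε D F x σI σII ≤ avgOp p s ε u x + δ := by
  obtain ⟨r, hr0, hr1, hr⟩ := exists_alive_le (N := N) hp hs0 hs1 hε hD
  obtain ⟨A, hA⟩ := hu.bounded
  obtain ⟨B, hB⟩ := hFb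
  set C := max A B with hC
  have huC : ∀ x, |u x| ≤ C := fun x => (hA x).trans (le_max_left _ _)
  have hFC : ∀ x, |F x| ≤ C := fun x => (hB x).trans (le_max_right _ _)
  have hC0 : 0 ≤ C := (abs_nonneg _).trans (huC 0)
  have hlim := (tendsto_pow_atTop_nhds_zero_of_lt_one hr0 hr1).const_mul (2 * C)
  rw [mul_zero] at hlim
  obtain ⟨n, hn⟩ := (hlim.eventually (gt_mem_nhds (half_pos hδ))).exists
  have hn0 : (0 : ℝ) < ((n + 1 : ℕ) : ℝ) := by positivity
  -- The errors of `n + 1` turns add up to `δ / 2`; by the choice of `n`, games lasting longer cost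
  -- less than another `δ / 2`.
  refine ⟨δ / 2 / ((n + 1 : ℕ) : ℝ), by positivity, fun σI σII hσ x => ?_⟩
  have h := expectedPayoff_le hp hs0 hs1 hε hDm hF hu.measurable
    (measurable_avgOp hp hs0 hs1 hε hu.measurable hu.bounded) hFC huC
    (abs_avgOp_le hp hs0 hs1 hε hu.measurable huC) hu.eq_data hu.eq_avgOp
    (by positivity) σI σII hσ x (n + 1)
  have h1 := mul_le_mul_of_nonneg_left (hr x σI σII n) (by positivity : 0 ≤ 2 * C)
  rw [mul_div_cancel₀ _ hn0.ne'] at h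
  linarith

/-- Turns the upper bound on the payoff into the lower bound that Player I needs. -/
lemma IsDPPSolution.neg {s ε : ℝ} {D : Set (E N)} {F u : E N → ℝ}
    (hu : IsDPPSolution p s ε D F u) :
    IsDPPSolution p s ε D (fun z => -F z) fun z => -u z where
  measurable := hu.measurable.neg
  bounded := by simpa using hu.bounded
  eq_avgOp x hx := by rw [avgOp_neg, hu.eq_avgOp x hx]
  eq_data x hx := by rw [hu.eq_data x hx]

/-- The game has a value, which is the average of the solution of the dynamic programming
principle. -/
lemma IsDPPSolution.value_eq {s : ℝ} (hp : 2 ≤ p) (hs0 : 0 < s) (hs1 : s < 1)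
    {ε : ℝ} (hε : 0 < ε) {D : Set (E N)} (hDm : MeasurableSet D) (hD : Bornology.IsBounded D)
    {F u : E N → ℝ} (hF : Measurable F) (hFb : ∃ C : ℝ, ∀ x, |F x| ≤ C)
    (hu : IsDPPSolution p s ε D F u) (x : E N) :
    valueI p s ε D F x = avgOp p s ε u x ∧ valueII p s ε D F x = avgOp p s ε u x := by
  obtain ⟨C, hC⟩ := hFb
  have hb := fun σI σII : Strategy N p =>
    abs_le.1 (abs_expectedPayoff_le hp hs0 hs1 ε D hC x σI σII)
  have hinf : ∀ σI : Strategy N p,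
      BddBelow (Set.range fun σII : Strategy N p => expectedPayoff s ε D F x σI σII) :=
    fun σI => ⟨-C, by rintro _ ⟨σII, rfl⟩; exact (hb σI σII).1⟩
  have hsup : ∀ σII : Strategy N p,
      BddAbove (Set.range fun σI : Strategy N p => expectedPayoff s ε D F x σI σII) :=
    fun σII => ⟨C, by rintro _ ⟨σI, rfl⟩; exact (hb σI σII).2⟩
  have hsupinf : BddAbove (Set.range fun σI : Strategy N p =>
      ⨅ σII : Strategy N p, expectedPayoff s ε D F x σI σII) :=
    ⟨C, by
      rintro _ ⟨σI, rfl⟩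
      exact (ciInf_le (hinf σI) (Classical.arbitrary _)).trans (hb σI _).2⟩
  have hinfsup : BddBelow (Set.range fun σII : Strategy N p =>
      ⨆ σI : Strategy N p, expectedPayoff s ε D F x σI σII) :=
    ⟨-C, by
      rintro _ ⟨σII, rfl⟩
      exact (hb _ σII).1.trans (le_ciSup (hsup σII) (Classical.arbitrary _))⟩
  have hle : valueI p s ε D F x ≤ valueII p s ε D F x :=
    ciSup_le fun σI => le_ciInf fun σII =>
      (ciInf_le (hinf σI) σII).trans (le_ciSup (hsup σII) σI)
  have hII : valueII p s ε D F x ≤ avgOp p s ε u x := by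
    refine le_of_forall_pos_le_add fun δ hδ => ?_
    obtain ⟨η, hη, h⟩ := hu.exists_expectedPayoff_le hp hs0 hs1 hε hDm hD hF ⟨C, hC⟩ hδ
    obtain ⟨φ, hφ, hmin⟩ := exists_measurable_almost_min hp hs0 hs1 hε hu.measurable hu.bounded hη
    -- Player II almost minimizes, and no direction of Player I beats the supremum, so each turn
    -- loses at most `η / 2`.
    refine (ciInf_le hinfsup (Strategy.ofPosition φ hφ)).trans (ciSup_le fun σI => ?_)
    refine h σI _ (fun n k => ?_) x
    have h1 := le_ciSup (bddAbove_coneAverage hp hs0 hs1 hε hu.measurable hu.bounded k.last)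
      (σI.toFun n k)
    have h2 := hmin k.last
    simp only [Strategy.ofPosition, avgOp]
    linarith
  have hI : avgOp p s ε u x ≤ valueI p s ε D F x := by
    refine le_of_forall_pos_le_add fun δ hδ => ?_
    obtain ⟨η, hη, h⟩ := hu.neg.exists_expectedPayoff_le hp hs0 hs1 hε hDm hD hF.neg (F := fun z => -F z)
      ⟨C, by simpa using hC⟩ hδ
    obtain ⟨φ, hφ, hmax⟩ := exists_measurable_almost_max hp hs0 hs1 hε hu.measurable hu.bounded hη
    rw [← sub_le_iff_le_add]
    -- Player I almost maximizes the averages of `u`; for `-u` this is the one-turn condition of the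
    -- upper bound.
    refine le_trans (le_ciInf fun σII => ?_) (le_ciSup hsupinf (Strategy.ofPosition φ hφ))
    have h0 := h (Strategy.ofPosition φ hφ) σII (fun n k => ?_) x
    · rw [expectedPayoff_neg, avgOp_neg] at h0
      linarith
    have h1 := ciInf_le (bddBelow_coneAverage hp hs0 hs1 hε hu.measurable hu.bounded k.last)
      (σII.toFun n k)
    have h2 := hmax k.last
    simp only [coneAverage_neg, avgOp_neg]
    simp only [Strategy.ofPosition, avgOp]
    linarith
  exact ⟨le_antisymm (hle.trans hII) hI, le_antisymm hII (hI.trans hle)⟩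

end Value
end NonlocalTug

theorem lemma7p1 (N : ℕ) [N.AtLeastTwo] (p s : ℝ) (hp : 2 ≤ p) (hs : s ∈ Set.Ioo (1 / 2 : ℝ) 1)
    (D : Set (NonlocalTug.E N)) (hDo : IsOpen D) (hDb : Bornology.IsBounded D)
    (F : NonlocalTug.E N → ℝ) (hFb : ∃ C : ℝ, ∀ x, |F x| ≤ C) (hFc : UniformContinuous F)
    (ε : ℝ) (hε : ε ∈ Set.Ioo (0 : ℝ) 1) :
    ∃ u : NonlocalTug.E N → ℝ,
      NonlocalTug.IsDPPSolution p s ε D F u ∧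
      (∀ v, NonlocalTug.IsDPPSolution p s ε D F v → v = u) ∧
      (∀ x, NonlocalTug.valueI p s ε D F x = NonlocalTug.valueII p s ε D F x) ∧
      ∀ x ∈ D, NonlocalTug.valueI p s ε D F x = u x ∧ NonlocalTug.valueII p s ε D F x = u x := by
  have hs0 : 0 < s := lt_trans (by norm_num) hs.1
  have hF := hFc.continuous.measurable
  obtain ⟨u, hu⟩ :=
    NonlocalTug.exists_isDPPSolution hp hs0 hs.2 hε.1 hDo.measurableSet hDb hF hFb
  have hval := hu.value_eq hp hs0 hs.2 hε.1 hDo.measurableSet hDb hF hFb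
  refine ⟨u, hu, fun v hv => hv.unique hp hs0 hs.2 hε.1 hDb hu, fun x => ?_, fun x hx => ?_⟩
  · rw [(hval x).1, (hval x).2]
  · rw [hu.eq_avgOp x hx]
    exact hval x
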